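/- Setting. Let $K\ge 2$, $D>0$, $\sigma\ge 0$, and let $\Sigma=(\sigma_{ij}^2)_{i,j\in[K]}$ have entries in $\{\sigma^2,\infty\}$, such that for every $j$ some $\sigma_{ij}^2$ is finite. Put $S_i=\{j:\sigma_{ij}^2<\infty\}$. Let $\theta\in[0,D]^K$ have a unique maximal entry $\theta_{i_1}$; put $d_i(\theta)=\max_j\theta_j-\theta_i$ and $d_{\min}(\theta)=\min_{i\ne i_1}d_i(\theta)>0$. If action $i$ is played in round $t$, the learner observes real random variables $X_{t,i,j}\sim\mathcal N(\theta_j,\sigma^2)$, $j\in S_i$, which are independent over $j$; the observations of different rounds are independent. An action $i$ is strongly observable if $i\in S_i$ or $i\in S_j$ for all $j\neq i$; since every action is observed by some action, the other actions are the weakly observable ones. $\rho(\Sigma)$ is the least size of a set $A\subset[K]$ such that every weakly observable action lies in $\bigcup_{i\in A}S_i$, and $\bar\rho=\max\{\rho(\Sigma),1\}$ (so $\bar\rho=\rho(\Sigma)$ as soon as some action is weakly observable). Algorithm (inputs $\Sigma$, $\sigma$, $D$, $\delta$). For $A,B\subset[K]$, $A\neq\emptyset$, let $c(A,B)$ be any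 maximiser of $\min_{i\in B}\sum_{j:i\in S_j}c_j$ over probability vectors $c$ on $A$ (extended by zero to $[K]$), and $m(A,B)$ the maximum; the minimum over the empty set is $+\infty$. Let $A^{\mathcal S}=\{i\in A:\exists j\in A,\ i\in S_j\}$ and $A^{\mathcal W}=A\setminus A^{\mathcal S}$. Start with $A_1=[K]$, $t_1=0$. In phase $r=1,2,\dots$, as long as $|A_r|\ge2$, let $n_i(r)$ be the number and $\hat\theta_{i,r}$ the average of all observations of action $i$ made before phase $r$, let $g_{i,r}=\sigma\sqrt{2\log(8K^2r^3/\delta)/n_i(r)}$, let $\alpha_r=\min\{m([K],A_s^{\mathcal W}):s\le r,\ A_s^{\mathcal W}\ne\emptyset\}$ ($\alpha_r=1$ if there is no such $s$), and $\gamma(r)=(\sigma\alpha_rt_r/D)^{2/3}$. If $A_r^{\mathcal W}\neq\emptyset$ and $\min_{i\in A_r^{\mathcal W}}n_i(r)<\min\{\min_{i\in A_r^{\mathcal S}}n_i(r),\gamma(r)\}$, let $c_r=c([K],A_r^{\mathcal W})$, otherwise $c_r=c(A_r,A_r^{\mathcal S})$. Play each action $i$ exactly $\lceil c_{r,i}\|c_r\|_0\rceil$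 times, in any order, where $\|c_r\|_0$ is the number of nonzero entries of $c_r$; let $t_{r+1}$ be $t_r$ plus the number of these plays, and $$A_{r+1}=\{i\in A_r:\hat\theta_{i,r+1}+g_{i,r+1}\ge\max_{j\in A_r}(\hat\theta_{j,r+1}-g_{j,r+1})\}.$$ Once $|A_{r+1}|=1$, play the remaining action in all remaining rounds. Let $R_T(\theta)=\sum_iN_i(T)d_i(\theta)$, where $N_i(T)$ is the number of plays of $i$ in the first $T$ rounds (no expectation is taken). Theorem. (a) For all $T\ge1$ and $\delta\in(0,1)$, with probability at least $1-\delta$, $$R_T(\theta)\le\frac{1603\,\bar\rho D\sigma^2}{d_{\min}^2(\theta)}\Big(\log\frac{2KT}{\delta}\Big)^{3/2}+14K^3D+\frac{125\sigma^2K^3}{D}+15\,(\bar\rho D\sigma^2)^{1/3}\Big(\frac{125\sigma^2}{D^2}+10\Big)K^2\Big(\log\frac{2KT}{\delta}\Big)^{1/2}.$$ (b) There is a constant $C$, depending only on $K,D,\sigma,\Sigma,\theta$, such that for all $T\ge2$ the algorithm run with $\delta=1/T$ satisfies $\mathbb E[R_T(\theta)]\le C(\log T)^{3/2}$. -/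

import Mathlib

open scoped NNReal ENNReal

noncomputable section

namespace SideObs

variable {K : ℕ}

/-! ### The feedback structure

`Sig i j` is the variance of the observation of action `j` that playing action `i` yields;
`Sig i j = ⊤` means that playing `i` gives no information about `j`. -/

open Classical in
/-- `S_i`, the set of actions that are observed when `i` is played. -/
def obsSet (Sig : Fin K → Fin K → ℝ≥0∞) (i : Fin K) : Finset (Fin K) :=
  Finset.univ.filter fun j => Sig i j < ⊤

/-- `i` is observed by playing `i` itself, or by playing any one of the other actions. -/
def StronglyObservable (Sig : Fin K → Fin K → ℝ≥0∞) (i : Fin K) : Prop :=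
  i ∈ obsSet Sig i ∨ ∀ j, j ≠ i → i ∈ obsSet Sig j

def WeaklyObservable (Sig : Fin K → Fin K → ℝ≥0∞) (i : Fin K) : Prop :=
  ¬ StronglyObservable Sig i ∧ ∃ j, i ∈ obsSet Sig j

/-- `A` dominates `B`: every action of `B` is observed by playing some action of `A`. -/
def Dominates (Sig : Fin K → Fin K → ℝ≥0∞) (A : Finset (Fin K)) (B : Set (Fin K)) : Prop :=
  ∀ j ∈ B, ∃ i ∈ A, j ∈ obsSet Sig i

/-- The weak domination number: the least size of a set of actions that dominates the set of
all weakly observable actions. -/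
def weakDominationNumber (Sig : Fin K → Fin K → ℝ≥0∞) : ℕ :=
  sInf {n | ∃ A : Finset (Fin K), A.card = n ∧ Dominates Sig A {i | WeaklyObservable Sig i}}

/-! ### Payoff gaps -/

/-- `d_i(θ)`, the gap between the largest mean payoff and the one of `i`. -/
def gap (θ : Fin K → ℝ) (i : Fin K) : ℝ := (⨆ j, θ j) - θ i

/-- The gap of the second best action, when `i₁` is the best one. -/
def minGap (θ : Fin K → ℝ) (i₁ : Fin K) : ℝ := ⨅ i : {i : Fin K // i ≠ i₁}, gap θ i

/-! ### The random environment -/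

/-- `X t i j` is the observation of action `j` obtained if action `i` is played in round `t`
(rounds are numbered from `0`). Nothing is required of entries of infinite variance, which are
never observed, nor of the joint law of the observations of one round across different played
actions `i`. -/
structure IsGaussianEnvironment {Ω : Type*} [MeasurableSpace Ω]
    (Sig : Fin K → Fin K → ℝ≥0∞) (θ : Fin K → ℝ) (P : MeasureTheory.Measure Ω)
    (X : ℕ → Fin K → Fin K → Ω → ℝ) : Prop where
  measurable : ∀ t i j, Measurable (X t i j)
  law : ∀ t i j, Sig i j < ⊤ →
    P.map (X t i j) = ProbabilityTheory.gaussianReal (θ j) (Sig i j).toNNReal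
  indep_coord : ∀ t i,
    ProbabilityTheory.iIndepFun (fun (j : {j : Fin K // Sig i j < ⊤}) => X t i j) P
  indep_time : ProbabilityTheory.iIndepFun
    (fun (t : ℕ) (ω : Ω) (p : {p : Fin K × Fin K // Sig p.1 p.2 < ⊤}) => X t p.1.1 p.1.2 ω) P

/-! ### The algorithm -/

/-- The minimum of `f` over `A`, with `⊤` as the minimum over the empty set. -/
def minOver (A : Finset (Fin K)) (f : Fin K → ℝ) : WithTop ℝ :=
  A.inf fun i => (f i : WithTop ℝ)

open Classical in
/-- `min_{i ∈ B} ∑_{j : i ∈ S_j} c_j`. -/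
def coverage (Sig : Fin K → Fin K → ℝ≥0∞) (B : Finset (Fin K)) (c : Fin K → ℝ) : WithTop ℝ :=
  minOver B fun i => ∑ j with i ∈ obsSet Sig j, c j

/-- The probability vectors on the set of all actions that vanish outside `A`. -/
def simplexOn (A : Finset (Fin K)) : Set (Fin K → ℝ) :=
  {c | c ∈ stdSimplex ℝ (Fin K) ∧ ∀ i, i ∉ A → c i = 0}

/-- The choices that the algorithm leaves open: for all `A` and `B` a maximiser `c(A, B)` of the
coverage of `B` over the probability vectors on `A`, and the order in which, in a given phase,
prescribed numbers of plays of the actions are carried out. -/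
structure Choices (Sig : Fin K → Fin K → ℝ≥0∞) where
  alloc : Finset (Fin K) → Finset (Fin K) → Fin K → ℝ
  alloc_mem : ∀ A B, A.Nonempty → alloc A B ∈ simplexOn A
  alloc_max : ∀ A B, A.Nonempty → ∀ c ∈ simplexOn A,
    coverage Sig B c ≤ coverage Sig B (alloc A B)
  order : ℕ → (Fin K → ℕ) → List (Fin K)
  order_count : ∀ r v i, (order r v).count i = v i

/-- `m(A, B)`. -/
def Choices.value {Sig : Fin K → Fin K → ℝ≥0∞} (ch : Choices Sig) (A B : Finset (Fin K)) :
    WithTop ℝ :=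
  coverage Sig B (ch.alloc A B)

open Classical in
/-- `A^S`, the actions of `A` that are observed by playing some action of `A`. -/
def strongPart (Sig : Fin K → Fin K → ℝ≥0∞) (A : Finset (Fin K)) : Finset (Fin K) :=
  A.filter fun i => ∃ j ∈ A, i ∈ obsSet Sig j

/-- `A^W = A \ A^S`. -/
def weakPart (Sig : Fin K → Fin K → ℝ≥0∞) (A : Finset (Fin K)) : Finset (Fin K) :=
  A \ strongPart Sig A

/-- The state of the algorithm at the start of phase `r`. -/
structure State (K : ℕ) where
  /-- the number `r` of the phase -/
  phase : ℕ
  /-- the actions played so far, in order -/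
  plays : List (Fin K)
  /-- the set `A_r` of good actions -/
  good : Finset (Fin K)
  /-- the sets `A_1, …, A_r` -/
  hist : Finset (Finset (Fin K))

def State.init (K : ℕ) : State K where
  phase := 1
  plays := []
  good := Finset.univ
  hist := {Finset.univ}

open Classical in
/-- The number of observations of action `i` in the rounds in which `plays` was played. -/
def obsCount (Sig : Fin K → Fin K → ℝ≥0∞) (plays : List (Fin K)) (i : Fin K) : ℕ :=
  plays.countP fun a => i ∈ obsSet Sig a

open Classical in
/-- The average of the observations of action `i` in the rounds in which `plays` was played, when
`x` is the realisation of the environment. -/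
def empMean (Sig : Fin K → Fin K → ℝ≥0∞) (x : ℕ → Fin K → Fin K → ℝ) (plays : List (Fin K))
    (i : Fin K) : ℝ :=
  (∑ t : Fin plays.length, if i ∈ obsSet Sig (plays.get t) then x t (plays.get t) i else 0) /
    (obsCount Sig plays i : ℝ)

/-- The confidence width `σ √(2 log (8 K² r³ / δ) / n)`. It is used only from the end of the first
phase on, when every action has been observed, so that `n` is positive. -/
def confWidth (K : ℕ) (σ : ℝ≥0) (δ : ℝ) (r n : ℕ) : ℝ :=
  (σ : ℝ) * Real.sqrt (2 * Real.log (8 * (K : ℝ) ^ 2 * (r : ℝ) ^ 3 / δ) / (n : ℝ))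

section Algorithm

variable {Sig : Fin K → Fin K → ℝ≥0∞} (ch : Choices Sig) (σ : ℝ≥0) (D δ : ℝ)
  (x : ℕ → Fin K → Fin K → ℝ)

open Classical in
/-- `α_r`: the minimum of `m([K], A_s^W)` over all `s ≤ r` with `A_s^W ≠ ∅`, and `1` if there is
no such `s`. -/
def alphaOf (s : State K) : ℝ :=
  ((s.hist.filter fun A => (weakPart Sig A).Nonempty).inf
    fun A => ch.value Finset.univ (weakPart Sig A)).untopD 1

/-- `γ(r) = (σ α_r t_r / D)^{2/3}`; the time `t_r` is the number of rounds played so far. -/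
def gammaOf (s : State K) : ℝ :=
  ((σ : ℝ) * alphaOf ch s * (s.plays.length : ℝ) / D) ^ ((2 : ℝ) / 3)

open Classical in
/-- The distribution `c_r` that phase `r` explores with. -/
def explore (s : State K) : Fin K → ℝ :=
  let n : Fin K → ℝ := fun i => (obsCount Sig s.plays i : ℝ)
  let AS := strongPart Sig s.good
  let AW := weakPart Sig s.good
  if AW.Nonempty ∧ minOver AW n < minOver AS n ∧
      minOver AW n < ((gammaOf ch σ D s : ℝ) : WithTop ℝ) then
    ch.alloc Finset.univ AW
  else
    ch.alloc s.good AS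

open Classical in
/-- The numbers of plays `⌈c · ‖c‖₀⌉`, where `‖c‖₀` is the number of nonzero entries of `c`. -/
def playCounts (c : Fin K → ℝ) (i : Fin K) : ℕ :=
  ⌈c i * ((Finset.univ.filter fun j => c j ≠ 0).card : ℝ)⌉₊

open Classical in
/-- The good actions that survive the elimination at the end of phase `s.phase`, after which the
actions played so far are `plays`. -/
def survivors (s : State K) (plays : List (Fin K)) : Finset (Fin K) :=
  let mean := empMean Sig x plays
  let g : Fin K → ℝ := fun i => confWidth K σ δ (s.phase + 1) (obsCount Sig plays i)
  s.good.filter fun i => ∀ j ∈ s.good, mean j - g j ≤ mean i + g i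

open Classical in
/-- One phase. Once a single good action is left it is played in all remaining rounds, which is
written as an endless sequence of phases of one round each. -/
def step (s : State K) : State K :=
  if s.good.card ≤ 1 then
    { s with phase := s.phase + 1, plays := s.plays ++ s.good.toList }
  else
    let plays := s.plays ++ ch.order s.phase (playCounts (explore ch σ D s))
    let good := survivors (Sig := Sig) σ δ x s plays
    { phase := s.phase + 1, plays := plays, good := good, hist := insert good s.hist }

/-- The state after `n` phases. -/
def run (n : ℕ) : State K := (step ch σ D δ x)^[n] (State.init K)

/-- The actions played in the first `T` rounds; `T` phases contain at least `T` rounds. -/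
def actions (T : ℕ) : List (Fin K) := (run ch σ D δ x T).plays.take T

/-- The regret `∑ i, N_i(T) d_i(θ)` of the first `T` rounds, without expectation. -/
def regret (θ : Fin K → ℝ) (T : ℕ) : ℝ :=
  ∑ i, ((actions ch σ D δ x T).count i : ℝ) * gap θ i

end Algorithm

end SideObs

end

/-! The regret is bounded path by path on the event `ConfidenceHolds`, with `L = log (2KT/δ)`. On it
the best action is never eliminated, and if every good action has been observed at least `ν` times,
then every good action has gap at most `4σ√(6L/ν)` (`ConfidenceHolds.gap_le`). So, from the second
phase on, while two good actions remain, the least observation count of a good action is at most `N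
= 96σ²L/d²`, where `d` is the minimal gap.

The plays fall into three groups. Phases that explore the weak part may play bad actions, at a cost
of up to `D` per round. Such a phase with support size `q` lasts at most `2q` rounds and gives each
target at least `αq` observations. `WeakBudget` charges it to a rise of the least count or, at most
`K` times, to an action targeted for the first time. Hence these phases take at most `2(Nρ + K² +
K)` rounds in all and, because of the cap `γ`, at most `2(K(σt/D)^{2/3} + K² + K)` of the first `t`
rounds. Ordinary phases started before `T₀ = (125σ²/D² + 10)K³` cost at most `D(T₀ + 2K)`. An
ordinary phase started at a later time `t` finds at least `(σt/(Dρ))^{2/3}` observations of each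
good action (`le_obsCount_of_late`): the strong ones have been served by all earlier ordinary
phases, and if a weak one lagged behind, the phase would have explored the weak part. It plays good
actions only, with gaps of order `√L (ρDσ²/t)^{1/3}`. Summing `t^{-1/3}` gives order `t^{2/3}`, and
`t^{2/3} ≤ N(Dρ/σ)^{2/3}` as long as two good actions remain; the product is of order
`ρDσ²L^{3/2}/d²`.

The sampling is adaptive, but the action of a round depends on earlier observations only, so the
exponential process `expMartingale` has expectation one (`lintegral_expMartingale`). Markov's
inequality for each possible value of the observation count, and a union bound over phases, actions
and counts, show that `ConfidenceHolds` fails with probability at most `δ`. For the expectation, `δ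
= 1/T` and the trivial bound `TD` on the bad event add only `D`. -/

noncomputable section

namespace SideObs

variable {K : ℕ}

/-! ### Allocations -/

open Classical in
/-- The number `‖c‖₀` of nonzero entries of `c`. -/
def supportCard (c : Fin K → ℝ) : ℕ := (Finset.univ.filter fun j => c j ≠ 0).card

lemma supportCard_le (c : Fin K → ℝ) : supportCard c ≤ K := by
  classical
  simpa [supportCard] using Finset.card_filter_le (Finset.univ : Finset (Fin K)) fun j => c j ≠ 0

lemma mul_supportCard_le_playCounts (c : Fin K → ℝ) (i : Fin K) :
    c i * supportCard c ≤ playCounts c i := Nat.le_ceil _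

lemma playCounts_eq_zero {c : Fin K → ℝ} {i : Fin K} (h : c i = 0) : playCounts c i = 0 := by
  simp [playCounts, h]

/-- Rounding up adds at most one play per nonzero entry, and the unrounded numbers sum to `‖c‖₀`
because `c` has mass one. -/
lemma sum_playCounts_le {c : Fin K → ℝ} (hc : c ∈ stdSimplex ℝ (Fin K)) :
    ((∑ i, playCounts c i : ℕ) : ℝ) ≤ 2 * supportCard c := by
  classical
  have h1 : ∀ i, (playCounts c i : ℝ) ≤ c i * supportCard c + if c i ≠ 0 then 1 else 0 := by
    intro i
    by_cases h : c i = 0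
    · simp [playCounts_eq_zero h, h]
    · rw [if_pos h]
      exact (Nat.ceil_lt_add_one (mul_nonneg (hc.1 i) (Nat.cast_nonneg _))).le
  push_cast
  calc ∑ i, (playCounts c i : ℝ)
      ≤ ∑ i, (c i * supportCard c + if c i ≠ 0 then 1 else 0) :=
        Finset.sum_le_sum fun i _ => h1 i
    _ = 2 * supportCard c := by
        rw [Finset.sum_add_distrib, ← Finset.sum_mul, hc.2, Finset.sum_boole]
        simp only [supportCard]
        ring

lemma length_order {Sig : Fin K → Fin K → ℝ≥0∞} (ch : Choices Sig) (r : ℕ) (v : Fin K → ℕ) :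
    (ch.order r v).length = ∑ i, v i := by
  classical
  have h := Multiset.sum_count_eq_card (s := Finset.univ)
    (m := ((ch.order r v : List (Fin K)) : Multiset (Fin K))) (fun _ _ => Finset.mem_univ _)
  rw [Multiset.coe_card] at h
  rw [← h]
  refine Finset.sum_congr rfl fun i _ => ?_
  rw [Multiset.coe_count]
  convert ch.order_count r v i

lemma mem_order {Sig : Fin K → Fin K → ℝ≥0∞} (ch : Choices Sig) {r : ℕ} {v : Fin K → ℕ}
    {i : Fin K} (hi : i ∈ ch.order r v) : v i ≠ 0 := by
  rw [← ch.order_count r v i]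
  exact (List.count_pos_iff.mpr hi).ne'

open Classical in
lemma obsCount_order {Sig : Fin K → Fin K → ℝ≥0∞} (ch : Choices Sig) (r : ℕ) (v : Fin K → ℕ)
    (i : Fin K) : obsCount Sig (ch.order r v) i = ∑ j with i ∈ obsSet Sig j, v j := by
  have h : ∀ l : List (Fin K), obsCount Sig l i = ∑ j with i ∈ obsSet Sig j, l.count j := by
    intro l
    induction l with
    | nil => simp [obsCount]
    | cons a l ih =>
      rw [obsCount, List.countP_cons]
      rw [obsCount] at ih
      rw [ih]
      simp only [List.count_cons, Finset.sum_add_distrib, beq_iff_eq, Finset.sum_ite_eq,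
        Finset.mem_filter, Finset.mem_univ, true_and]
      simp
  rw [h]
  refine Finset.sum_congr rfl fun j _ => ?_
  convert ch.order_count r v j

lemma obsCount_append (Sig : Fin K → Fin K → ℝ≥0∞) (l l' : List (Fin K)) (i : Fin K) :
    obsCount Sig (l ++ l') i = obsCount Sig l i + obsCount Sig l' i := by
  simp [obsCount, List.countP_append]

lemma obsCount_le_length (Sig : Fin K → Fin K → ℝ≥0∞) (l : List (Fin K)) (i : Fin K) :
    obsCount Sig l i ≤ l.length := List.countP_le_length

lemma minOver_le {A : Finset (Fin K)} {f : Fin K → ℝ} {i : Fin K} (hi : i ∈ A) :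
    minOver A f ≤ (f i : WithTop ℝ) := Finset.inf_le (f := fun i => (f i : WithTop ℝ)) hi

lemma le_minOver {A : Finset (Fin K)} {f : Fin K → ℝ} {b : WithTop ℝ}
    (h : ∀ i ∈ A, b ≤ (f i : WithTop ℝ)) : b ≤ minOver A f := Finset.le_inf h

lemma exists_minOver_eq {A : Finset (Fin K)} (hA : A.Nonempty) (f : Fin K → ℝ) :
    ∃ i ∈ A, minOver A f = (f i : WithTop ℝ) := by
  obtain ⟨i, hi, h⟩ := Finset.exists_min_image A f hA
  exact ⟨i, hi, le_antisymm (minOver_le hi)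
    (le_minOver fun j hj => WithTop.coe_le_coe.mpr (h j hj))⟩

/-- A set `B` whose coverage is at least `m` collects at least `m ‖c‖₀` observations of each of
its actions from the plays prescribed by `c`. -/
lemma mul_supportCard_le_obsCount {Sig : Fin K → Fin K → ℝ≥0∞} (ch : Choices Sig) (r : ℕ)
    {B : Finset (Fin K)} {c : Fin K → ℝ} {m : ℝ} (hm : (m : WithTop ℝ) ≤ coverage Sig B c)
    {i : Fin K} (hi : i ∈ B) :
    m * supportCard c ≤ obsCount Sig (ch.order r (playCounts c)) i := by
  classical
  rw [obsCount_order]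
  have h1 : m ≤ ∑ j with i ∈ obsSet Sig j, c j :=
    WithTop.coe_le_coe.mp (hm.trans (minOver_le hi))
  push_cast
  calc m * supportCard c ≤ (∑ j with i ∈ obsSet Sig j, c j) * supportCard c :=
        mul_le_mul_of_nonneg_right h1 (Nat.cast_nonneg _)
    _ ≤ _ := by
        rw [Finset.sum_mul]
        exact Finset.sum_le_sum fun j _ => mul_supportCard_le_playCounts c j

lemma supportCard_pos {c : Fin K → ℝ} (hc : c ∈ stdSimplex ℝ (Fin K)) : 0 < supportCard c := by
  classical
  rw [supportCard, Finset.card_pos]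
  by_contra h
  rw [Finset.not_nonempty_iff_eq_empty, Finset.filter_eq_empty_iff] at h
  have h0 : ∑ i, c i = 0 := Finset.sum_eq_zero fun i hi => by simpa using h hi
  rw [hc.2] at h0
  exact one_ne_zero h0

open Classical in
/-- The uniform distribution on `A`. -/
def uniformOn (A : Finset (Fin K)) (i : Fin K) : ℝ := if i ∈ A then (A.card : ℝ)⁻¹ else 0

lemma uniformOn_mem_simplexOn {A : Finset (Fin K)} (hA : A.Nonempty) :
    uniformOn A ∈ simplexOn A := by
  classical
  refine ⟨⟨fun i => ?_, ?_⟩, fun i hi => by simp [uniformOn, hi]⟩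
  · unfold uniformOn; split_ifs <;> positivity
  · have : (A.card : ℝ) ≠ 0 := by simpa using hA.ne_empty
    simp [uniformOn, Finset.sum_ite_mem, this]

lemma coverage_uniformOn_ge {Sig : Fin K → Fin K → ℝ≥0∞} {A B : Finset (Fin K)}
    (h : ∀ i ∈ B, ∃ j ∈ A, i ∈ obsSet Sig j) :
    (((A.card : ℝ)⁻¹ : ℝ) : WithTop ℝ) ≤ coverage Sig B (uniformOn A) := by
  classical
  refine le_minOver fun i hi => WithTop.coe_le_coe.mpr ?_
  obtain ⟨j, hj, hij⟩ := h i hi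
  have := Finset.single_le_sum (f := uniformOn A)
    (s := Finset.univ.filter fun j => i ∈ obsSet Sig j)
    (fun k _ => by unfold uniformOn; split_ifs <;> positivity)
    (Finset.mem_filter.mpr ⟨Finset.mem_univ j, hij⟩)
  simpa [uniformOn, hj] using this

/-- Each action of the strong part is observed from within `A`, so already the uniform distribution
on `A` covers it with weight `1/|A| ≥ 1/K`. -/
lemma value_strongPart_ge {Sig : Fin K → Fin K → ℝ≥0∞} (ch : Choices Sig)
    {A : Finset (Fin K)} (hA : A.Nonempty) :
    (((K : ℝ)⁻¹ : ℝ) : WithTop ℝ) ≤ ch.value A (strongPart Sig A) := by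
  classical
  refine le_trans ?_ ((coverage_uniformOn_ge (A := A) (B := strongPart Sig A) ?_).trans
    (ch.alloc_max A (strongPart Sig A) hA _ (uniformOn_mem_simplexOn hA)))
  · refine WithTop.coe_le_coe.mpr (inv_anti₀ (by exact_mod_cast hA.card_pos) ?_)
    exact_mod_cast (Finset.card_le_univ A).trans_eq (Fintype.card_fin K)
  · intro i hi
    exact (Finset.mem_filter.mp hi).2

/-! ### Strong and weak parts, and their relation to domination. -/

lemma mem_weakPart {Sig : Fin K → Fin K → ℝ≥0∞} {A : Finset (Fin K)} {i : Fin K} :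
    i ∈ weakPart Sig A ↔ i ∈ A ∧ ∀ j ∈ A, i ∉ obsSet Sig j := by
  classical
  simp only [weakPart, strongPart, Finset.mem_sdiff, Finset.mem_filter]
  grind

lemma mem_strongPart {Sig : Fin K → Fin K → ℝ≥0∞} {A : Finset (Fin K)} {i : Fin K} :
    i ∈ strongPart Sig A ↔ i ∈ A ∧ ∃ j ∈ A, i ∈ obsSet Sig j := by
  classical
  simp only [strongPart, Finset.mem_filter]

lemma mem_strongPart_or_weakPart {Sig : Fin K → Fin K → ℝ≥0∞} {A : Finset (Fin K)} {i : Fin K}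
    (hi : i ∈ A) : i ∈ strongPart Sig A ∨ i ∈ weakPart Sig A := by
  rw [mem_weakPart, mem_strongPart]
  grind

lemma mem_obsSet {Sig : Fin K → Fin K → ℝ≥0∞} {i j : Fin K} :
    j ∈ obsSet Sig i ↔ Sig i j < ⊤ := by
  classical
  simp [obsSet]

lemma weakPart_univ {Sig : Fin K → Fin K → ℝ≥0∞} (hobs : ∀ j, ∃ i, Sig i j < ⊤) :
    weakPart Sig Finset.univ = ∅ := by
  ext i
  simp only [mem_weakPart, mem_obsSet, Finset.mem_univ, true_and, Finset.notMem_empty,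
    iff_false, forall_const]
  push Not
  exact hobs i

lemma strongPart_univ {Sig : Fin K → Fin K → ℝ≥0∞} (hobs : ∀ j, ∃ i, Sig i j < ⊤) :
    strongPart Sig Finset.univ = Finset.univ := by
  ext i
  simpa [mem_strongPart, mem_obsSet] using hobs i

/-- A strongly observable action is seen by itself or by any other action; a set with two elements
that contains it therefore observes it. This fails for singletons, whence the condition on the
cardinality. -/
lemma weaklyObservable_of_mem_weakPart {Sig : Fin K → Fin K → ℝ≥0∞}
    (hobs : ∀ j, ∃ i, Sig i j < ⊤) {A : Finset (Fin K)} (hA : 2 ≤ A.card) {i : Fin K}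
    (hi : i ∈ weakPart Sig A) : WeaklyObservable Sig i := by
  rw [mem_weakPart] at hi
  refine ⟨?_, (hobs i).imp fun j hj => mem_obsSet.mpr hj⟩
  rintro (h | h)
  · exact hi.2 i hi.1 h
  · obtain ⟨j, hj, hji⟩ := Finset.exists_mem_ne (show 1 < A.card by omega) i
    exact hi.2 j hj (h j hji)

lemma exists_dominating {Sig : Fin K → Fin K → ℝ≥0∞} :
    ∃ A : Finset (Fin K), A.card = weakDominationNumber Sig ∧
      Dominates Sig A {i | WeaklyObservable Sig i} :=
  Nat.sInf_mem (s := {n | ∃ A : Finset (Fin K), A.card = n ∧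
    Dominates Sig A {i | WeaklyObservable Sig i}})
    ⟨_, Finset.univ, rfl, fun j hj => by
      obtain ⟨i, hi⟩ := hj.2
      exact ⟨i, Finset.mem_univ i, hi⟩⟩

lemma weakDominationNumber_le (Sig : Fin K → Fin K → ℝ≥0∞) : weakDominationNumber Sig ≤ K := by
  obtain ⟨A, hA, -⟩ := exists_dominating (Sig := Sig)
  rw [← hA]
  exact (Finset.card_le_univ A).trans_eq (Fintype.card_fin K)

lemma simplexOn_subset_univ {A : Finset (Fin K)} {c : Fin K → ℝ} (hc : c ∈ simplexOn A) :
    c ∈ simplexOn (Finset.univ : Finset (Fin K)) := ⟨hc.1, fun i hi => absurd (Finset.mem_univ i) hi⟩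

/-- The competitor is the uniform distribution on a minimal dominating set. It may lie outside `A`,
which is why the weak part is explored with all actions. -/
lemma value_weakPart_ge {Sig : Fin K → Fin K → ℝ≥0∞} (ch : Choices Sig)
    (hobs : ∀ j, ∃ i, Sig i j < ⊤) {A : Finset (Fin K)} (hA : 2 ≤ A.card)
    (hW : (weakPart Sig A).Nonempty) :
    (((max (weakDominationNumber Sig : ℝ) 1)⁻¹ : ℝ) : WithTop ℝ) ≤
      ch.value Finset.univ (weakPart Sig A) := by
  obtain ⟨E, hE, hdom⟩ := exists_dominating (Sig := Sig)
  have hcov : ∀ i ∈ weakPart Sig A, ∃ j ∈ E, i ∈ obsSet Sig j := fun i hi =>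
    hdom i (weaklyObservable_of_mem_weakPart hobs hA hi)
  obtain ⟨i, hi⟩ := hW
  have hEne : E.Nonempty := (hcov i hi).imp fun j hj => hj.1
  refine le_trans ?_ ((coverage_uniformOn_ge hcov).trans
    (ch.alloc_max Finset.univ _ ⟨i, Finset.mem_univ i⟩ _
      (simplexOn_subset_univ (uniformOn_mem_simplexOn hEne))))
  rw [← hE]
  exact WithTop.coe_le_coe.mpr (inv_anti₀ (by exact_mod_cast hEne.card_pos) (le_max_left _ _))

lemma coverage_le_one {Sig : Fin K → Fin K → ℝ≥0∞} {B : Finset (Fin K)} (hB : B.Nonempty)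
    {c : Fin K → ℝ} (hc : c ∈ stdSimplex ℝ (Fin K)) : coverage Sig B c ≤ ((1 : ℝ) : WithTop ℝ) := by
  classical
  obtain ⟨i, hi⟩ := hB
  refine (minOver_le hi).trans (WithTop.coe_le_coe.mpr ?_)
  rw [← hc.2]
  exact Finset.sum_le_sum_of_subset_of_nonneg (Finset.filter_subset _ _) fun j _ _ => hc.1 j

/-! ### The parameter `α` -/

section Alpha

variable {Sig : Fin K → Fin K → ℝ≥0∞} (ch : Choices Sig)

open Classical in
/-- The minimum of `m([K], A^W)` over the sets `A` of the history with `A^W ≠ ∅`. -/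
def alphaInf (s : State K) : WithTop ℝ :=
  (s.hist.filter fun A => (weakPart Sig A).Nonempty).inf
    fun A => ch.value Finset.univ (weakPart Sig A)

lemma alphaInf_le_value {s : State K} {A : Finset (Fin K)} (hA : A ∈ s.hist)
    (hW : (weakPart Sig A).Nonempty) :
    alphaInf ch s ≤ ch.value Finset.univ (weakPart Sig A) := by
  classical
  exact Finset.inf_le (f := fun A => ch.value Finset.univ (weakPart Sig A))
    (Finset.mem_filter.mpr ⟨hA, hW⟩)

/-- The default value `1` plays no role here: a probability vector covers a nonempty set with weight
at most one, so the infimum is finite. -/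
lemma alphaOf_coe_le {s : State K} {A : Finset (Fin K)} (hA : A ∈ s.hist)
    (hW : (weakPart Sig A).Nonempty) :
    ((alphaOf ch s : ℝ) : WithTop ℝ) ≤ ch.value Finset.univ (weakPart Sig A) := by
  have h := alphaInf_le_value ch hA hW
  obtain ⟨i, hi⟩ := hW
  have h1 : alphaInf ch s ≠ ⊤ := by
    refine ne_top_of_le_ne_top ?_ (h.trans (coverage_le_one ⟨i, hi⟩
      (ch.alloc_mem Finset.univ _ ⟨i, Finset.mem_univ i⟩).1))
    exact WithTop.coe_ne_top
  have h2 : ((alphaOf ch s : ℝ) : WithTop ℝ) = alphaInf ch s := by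
    obtain ⟨a, ha⟩ := WithTop.ne_top_iff_exists.mp h1
    have : alphaOf ch s = (alphaInf ch s).untopD 1 := rfl
    rw [this, ← ha]
    rfl
  rwa [h2]

/-- The delicate case is the passage from the default `1` to a genuine minimum; it cannot raise `α`
since coverages of nonempty sets are at most one. -/
lemma alphaOf_le_of_subset {s s' : State K} (h : s.hist ⊆ s'.hist) :
    alphaOf ch s' ≤ alphaOf ch s := by
  classical
  have h0 : alphaInf ch s' ≤ alphaInf ch s :=
    Finset.inf_mono (Finset.filter_subset_filter _ h)
  have e : ∀ s : State K, alphaOf ch s = (alphaInf ch s).untopD 1 := fun _ => rfl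
  by_cases hs' : ∃ A ∈ s'.hist, (weakPart Sig A).Nonempty
  · obtain ⟨A, hA, hW⟩ := hs'
    have h1 : ((alphaOf ch s' : ℝ) : WithTop ℝ) ≤ ((1 : ℝ) : WithTop ℝ) :=
      (alphaOf_coe_le ch hA hW).trans (coverage_le_one hW
        (ch.alloc_mem Finset.univ _ (hW.mono (Finset.subset_univ _))).1)
    by_cases ht : alphaInf ch s = ⊤
    · rw [e s, ht]
      exact WithTop.coe_le_coe.mp h1
    · have ht' := ne_top_of_le_ne_top ht h0
      rw [e, e]
      obtain ⟨a, ha⟩ := WithTop.ne_top_iff_exists.mp ht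
      obtain ⟨b, hb⟩ := WithTop.ne_top_iff_exists.mp ht'
      rw [← ha, ← hb] at h0 ⊢
      exact WithTop.coe_le_coe.mp h0
  · have ht : ∀ s : State K, (∀ A ∈ s.hist, ¬ (weakPart Sig A).Nonempty) → alphaOf ch s = 1 := by
      intro s hs
      rw [e, alphaInf, Finset.filter_false_of_mem hs]
      rfl
    push Not at hs'
    rw [ht s' fun A hA => by simp [hs' A hA], ht s fun A hA => by simp [hs' A (h hA)]]

lemma inv_le_alphaOf (hobs : ∀ j, ∃ i, Sig i j < ⊤) {s : State K}
    (hs : ∀ A ∈ s.hist, 2 ≤ A.card) :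
    (max (weakDominationNumber Sig : ℝ) 1)⁻¹ ≤ alphaOf ch s := by
  classical
  have e : alphaOf ch s = (alphaInf ch s).untopD 1 := rfl
  have h : (((max (weakDominationNumber Sig : ℝ) 1)⁻¹ : ℝ) : WithTop ℝ) ≤ alphaInf ch s := by
    refine Finset.le_inf fun A hA => ?_
    rw [Finset.mem_filter] at hA
    exact value_weakPart_ge ch hobs (hs A hA.1) hA.2
  rw [e]
  by_cases ht : alphaInf ch s = ⊤
  · rw [ht]
    exact inv_le_one_of_one_le₀ (le_max_right _ _)
  · obtain ⟨a, ha⟩ := WithTop.ne_top_iff_exists.mp ht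
    rw [← ha] at h ⊢
    exact WithTop.coe_le_coe.mp h

lemma alphaOf_le_one_of_weakPart_eq_empty (s : State K) (hs : ∀ A ∈ s.hist, weakPart Sig A = ∅) :
    alphaOf ch s ≤ 1 := by
  classical
  have e : alphaOf ch s = (alphaInf ch s).untopD 1 := rfl
  rw [e, alphaInf, Finset.filter_false_of_mem fun A hA => by simp [hs A hA]]
  exact le_rfl

end Alpha

/-! ### The structure of a run -/

section Run

variable {Sig : Fin K → Fin K → ℝ≥0∞} (ch : Choices Sig) (σ : ℝ≥0) (D δ : ℝ)
  (x : ℕ → Fin K → Fin K → ℝ)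

/-- The phase explores the weakly observed part of the good actions. -/
def IsWeakPhase (s : State K) : Prop :=
  (weakPart Sig s.good).Nonempty ∧
    minOver (weakPart Sig s.good) (fun i => (obsCount Sig s.plays i : ℝ)) <
      minOver (strongPart Sig s.good) (fun i => (obsCount Sig s.plays i : ℝ)) ∧
    minOver (weakPart Sig s.good) (fun i => (obsCount Sig s.plays i : ℝ)) <
      ((gammaOf ch σ D s : ℝ) : WithTop ℝ)

lemma explore_of_isWeakPhase {s : State K} (h : IsWeakPhase ch σ D s) :
    explore ch σ D s = ch.alloc Finset.univ (weakPart Sig s.good) := if_pos h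

lemma explore_of_not_isWeakPhase {s : State K} (h : ¬ IsWeakPhase ch σ D s) :
    explore ch σ D s = ch.alloc s.good (strongPart Sig s.good) := if_neg h

/-- The plays of the phase that starts in the state `s`. -/
def phasePlays (s : State K) : List (Fin K) :=
  if s.good.card ≤ 1 then s.good.toList
  else ch.order s.phase (playCounts (explore ch σ D s))

lemma step_plays (s : State K) :
    (step ch σ D δ x s).plays = s.plays ++ phasePlays ch σ D s := by
  unfold step phasePlays
  split_ifs <;> rfl

lemma step_phase (s : State K) : (step ch σ D δ x s).phase = s.phase + 1 := by
  unfold step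
  split_ifs <;> rfl

lemma step_good_of_card_le {s : State K} (h : s.good.card ≤ 1) :
    (step ch σ D δ x s).good = s.good := by
  simp [step, h]

lemma step_good_of_two_le {s : State K} (h : 2 ≤ s.good.card) :
    (step ch σ D δ x s).good =
      survivors (Sig := Sig) σ δ x s (s.plays ++ phasePlays ch σ D s) := by
  have h' : ¬ s.good.card ≤ 1 := by omega
  simp [step, phasePlays, h']

lemma step_good_subset (s : State K) : (step ch σ D δ x s).good ⊆ s.good := by
  classical
  rcases Nat.lt_or_ge 1 s.good.card with h | h
  · rw [step_good_of_two_le ch σ D δ x h]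
    exact Finset.filter_subset _ _
  · rw [step_good_of_card_le ch σ D δ x h]

lemma hist_subset_step_hist (s : State K) : s.hist ⊆ (step ch σ D δ x s).hist := by
  unfold step
  split_ifs
  · exact subset_rfl
  · exact Finset.subset_insert _ _

lemma mem_step_hist {s : State K} {A : Finset (Fin K)} (hA : A ∈ (step ch σ D δ x s).hist) :
    A ∈ s.hist ∨ A = (step ch σ D δ x s).good := by
  unfold step at hA ⊢
  split_ifs at hA ⊢
  · exact Or.inl hA
  · exact (Finset.mem_insert.mp hA).symm

lemma step_good_mem_hist {s : State K} (hs : s.good ∈ s.hist) :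
    (step ch σ D δ x s).good ∈ (step ch σ D δ x s).hist := by
  unfold step
  split_ifs
  · exact hs
  · exact Finset.mem_insert_self _ _

lemma run_zero : run ch σ D δ x 0 = State.init K := rfl

lemma run_succ (n : ℕ) : run ch σ D δ x (n + 1) = step ch σ D δ x (run ch σ D δ x n) :=
  Function.iterate_succ_apply' _ _ _

lemma run_phase (n : ℕ) : (run ch σ D δ x n).phase = n + 1 := by
  induction n with
  | zero => rfl
  | succ n ih => rw [run_succ, step_phase, ih]

lemma run_good_mem_hist (n : ℕ) : (run ch σ D δ x n).good ∈ (run ch σ D δ x n).hist := by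
  induction n with
  | zero => exact Finset.mem_singleton_self _
  | succ n ih => rw [run_succ]; exact step_good_mem_hist ch σ D δ x ih

lemma run_good_subset_of_mem_hist (n : ℕ) {A : Finset (Fin K)}
    (hA : A ∈ (run ch σ D δ x n).hist) : (run ch σ D δ x n).good ⊆ A := by
  induction n with
  | zero => rw [Finset.mem_singleton.mp hA]; exact subset_rfl
  | succ n ih =>
    rw [run_succ] at hA ⊢
    rcases mem_step_hist ch σ D δ x hA with h | h
    · exact (step_good_subset ch σ D δ x _).trans (ih h)
    · rw [h]

/-- Good sets decrease, so all sets in the history have at least two elements as long as the current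
one does. -/
lemma inv_le_alphaOf_run (hobs : ∀ j, ∃ i, Sig i j < ⊤) {n : ℕ}
    (h : 2 ≤ (run ch σ D δ x n).good.card) :
    (max (weakDominationNumber Sig : ℝ) 1)⁻¹ ≤ alphaOf ch (run ch σ D δ x n) :=
  inv_le_alphaOf ch hobs fun _ hA =>
    h.trans (Finset.card_le_card (run_good_subset_of_mem_hist ch σ D δ x n hA))

lemma good_nonempty {s : State K} (h : 2 ≤ s.good.card) : s.good.Nonempty :=
  Finset.card_pos.mp (by omega)

lemma explore_mem_stdSimplex {s : State K} (h : 2 ≤ s.good.card) :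
    explore ch σ D s ∈ stdSimplex ℝ (Fin K) := by
  by_cases hw : IsWeakPhase ch σ D s
  · rw [explore_of_isWeakPhase ch σ D hw]
    exact (ch.alloc_mem _ _ ((good_nonempty h).mono (Finset.subset_univ _))).1
  · rw [explore_of_not_isWeakPhase ch σ D hw]
    exact (ch.alloc_mem _ _ (good_nonempty h)).1

lemma phasePlays_of_two_le {s : State K} (h : 2 ≤ s.good.card) :
    phasePlays ch σ D s = ch.order s.phase (playCounts (explore ch σ D s)) :=
  if_neg (by omega)

lemma length_phasePlays_le {s : State K} (h : 2 ≤ s.good.card) :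
    ((phasePlays ch σ D s).length : ℝ) ≤ 2 * supportCard (explore ch σ D s) := by
  rw [phasePlays_of_two_le ch σ D h, length_order]
  exact sum_playCounts_le (explore_mem_stdSimplex ch σ D h)

lemma length_phasePlays_le_two_mul (s : State K) : (phasePlays ch σ D s).length ≤ 2 * K := by
  rcases Nat.lt_or_ge 1 s.good.card with h | h
  · have h1 := length_phasePlays_le ch σ D h
    have h2 := supportCard_le (explore ch σ D s)
    have h3 : ((phasePlays ch σ D s).length : ℝ) ≤ ((2 * supportCard (explore ch σ D s) : ℕ) : ℝ) := by
      exact_mod_cast h1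
    have h4 := Nat.cast_le.mp h3
    omega
  · rw [phasePlays, if_pos h, Finset.length_toList]
    have := (Finset.card_le_univ s.good).trans_eq (Fintype.card_fin K)
    omega

lemma length_run_plays_le (n : ℕ) : (run ch σ D δ x n).plays.length ≤ 2 * K * n := by
  induction n with
  | zero => simp [run_zero, State.init]
  | succ n ih =>
    rw [run_succ, step_plays, List.length_append]
    have := length_phasePlays_le_two_mul ch σ D (run ch σ D δ x n)
    rw [Nat.mul_succ]
    omega

/-- In a phase that does not explore the weak part only good actions are played. -/
lemma mem_good_of_mem_phasePlays {s : State K} (hw : ¬ IsWeakPhase ch σ D s) {a : Fin K}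
    (ha : a ∈ phasePlays ch σ D s) : a ∈ s.good := by
  unfold phasePlays at ha
  split_ifs at ha with h
  · exact Finset.mem_toList.mp ha
  · by_contra hna
    refine mem_order ch ha (playCounts_eq_zero ?_)
    rw [explore_of_not_isWeakPhase ch σ D hw]
    exact (ch.alloc_mem _ _ (good_nonempty (by omega))).2 a hna

lemma not_isWeakPhase_init (hobs : ∀ j, ∃ i, Sig i j < ⊤) :
    ¬ IsWeakPhase ch σ D (State.init K) := fun h => by
  have h1 := h.1
  rw [show (State.init K).good = Finset.univ from rfl, weakPart_univ hobs] at h1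
  exact Finset.not_nonempty_empty h1

/-- Observations of the strongly observed good actions made in an ordinary phase. -/
lemma obsCount_phasePlays_strong {s : State K} (h : 2 ≤ s.good.card)
    (hw : ¬ IsWeakPhase ch σ D s) {i : Fin K} (hi : i ∈ strongPart Sig s.good) :
    (K : ℝ)⁻¹ * supportCard (explore ch σ D s) ≤ obsCount Sig (phasePlays ch σ D s) i := by
  rw [phasePlays_of_two_le ch σ D h]
  refine mul_supportCard_le_obsCount ch _ ?_ hi
  rw [explore_of_not_isWeakPhase ch σ D hw]
  exact value_strongPart_ge ch (good_nonempty h)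

/-- Observations of the weakly observed good actions made in a phase that explores them. -/
lemma obsCount_phasePlays_weak {s : State K} (h : 2 ≤ s.good.card) (hs : s.good ∈ s.hist)
    (hw : IsWeakPhase ch σ D s) {i : Fin K} (hi : i ∈ weakPart Sig s.good) :
    alphaOf ch s * supportCard (explore ch σ D s) ≤ obsCount Sig (phasePlays ch σ D s) i := by
  rw [phasePlays_of_two_le ch σ D h]
  refine mul_supportCard_le_obsCount ch _ ?_ hi
  rw [explore_of_isWeakPhase ch σ D hw]
  exact alphaOf_coe_le ch hs hw.1

/-- After the first phase every action has been observed. -/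
lemma one_le_obsCount_run (hK : 2 ≤ K) (hobs : ∀ j, ∃ i, Sig i j < ⊤) (n : ℕ) (i : Fin K) :
    1 ≤ obsCount Sig (run ch σ D δ x (n + 1)).plays i := by
  induction n with
  | zero =>
    rw [run_succ, step_plays, obsCount_append]
    have hc : 2 ≤ (State.init K).good.card := by simpa [State.init] using hK
    have h1 := obsCount_phasePlays_strong ch σ D hc (not_isWeakPhase_init ch σ D hobs) (i := i)
      (by rw [show (State.init K).good = Finset.univ from rfl, strongPart_univ hobs]
          exact Finset.mem_univ i)
    have h2 := supportCard_pos (explore_mem_stdSimplex ch σ D hc)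
    have h3 : (0 : ℝ) < (K : ℝ)⁻¹ * supportCard (explore ch σ D (State.init K)) := by positivity
    have h4 : 0 < obsCount Sig (phasePlays ch σ D (State.init K)) i := by
      exact_mod_cast h3.trans_le h1
    rw [run_zero]
    omega
  | succ n ih =>
    rw [run_succ, step_plays, obsCount_append]
    omega

/-! ### Which observations a run depends on -/

/-- `x` and `y` agree on the observations that can be made before round `t`. -/
def AgreeBefore (Sig : Fin K → Fin K → ℝ≥0∞) (t : ℕ) (x y : ℕ → Fin K → Fin K → ℝ) : Prop :=
  ∀ s < t, ∀ i j, Sig i j < ⊤ → x s i j = y s i j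

variable {x} {y : ℕ → Fin K → Fin K → ℝ}

lemma empMean_congr {plays : List (Fin K)} (h : AgreeBefore Sig plays.length x y) (i : Fin K) :
    empMean Sig x plays i = empMean Sig y plays i := by
  classical
  unfold empMean
  congr 1
  refine Finset.sum_congr rfl fun t _ => ?_
  split_ifs with hi
  · exact h t t.2 _ _ (mem_obsSet.mp hi)
  · rfl

lemma step_congr {s : State K}
    (h : AgreeBefore Sig (s.plays ++ phasePlays ch σ D s).length x y) :
    step ch σ D δ x s = step ch σ D δ y s := by
  classical
  by_cases hc : s.good.card ≤ 1
  · simp [step, hc]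
  · have hs : survivors (Sig := Sig) σ δ x s (s.plays ++ phasePlays ch σ D s) =
        survivors (Sig := Sig) σ δ y s (s.plays ++ phasePlays ch σ D s) := by
      simp only [survivors, empMean_congr h]
    simp only [phasePlays, hc, if_false] at hs
    simp only [step, hc, if_false, hs]

/-- Observations influence a run only at the ends of phases. The two runs coincide until a phase
reaches beyond round `t`; that phase starts from a common state, which already fixes its plays, and
later phases only append. -/
lemma run_congr {t : ℕ} (h : AgreeBefore Sig t x y) (n : ℕ) :
    run ch σ D δ x n = run ch σ D δ y n ∨
      (t < (run ch σ D δ x n).plays.length ∧ t < (run ch σ D δ y n).plays.length ∧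
        (run ch σ D δ x n).plays.take (t + 1) = (run ch σ D δ y n).plays.take (t + 1)) := by
  induction n with
  | zero => exact Or.inl rfl
  | succ n ih =>
    simp only [run_succ]
    rcases ih with ih | ⟨h1, h2, h3⟩
    · rw [ih]
      set s := run ch σ D δ y n
      rcases Nat.lt_or_ge t (s.plays ++ phasePlays ch σ D s).length with hl | hl
      · right
        simp only [step_plays]
        exact ⟨hl, hl, trivial⟩
      · left
        exact step_congr ch σ D δ fun u hu => h u (by omega)
    · right
      simp only [step_plays, List.length_append]
      refine ⟨by omega, by omega, ?_⟩
      rw [List.take_append_of_le_length h1, List.take_append_of_le_length h2, h3]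

/-- The action played in round `t` depends on the observations of earlier rounds only. -/
lemma run_plays_getElem?_congr {t : ℕ} (h : AgreeBefore Sig t x y) (n : ℕ) :
    (run ch σ D δ x n).plays[t]? = (run ch σ D δ y n).plays[t]? := by
  rcases run_congr ch σ D δ h n with h1 | ⟨-, -, h3⟩
  · rw [h1]
  · have := congrArg (fun l => l[t]?) h3
    simpa [List.getElem?_take] using this

end Run

/-! ### Gaps -/

section Gaps

variable {θ : Fin K → ℝ} {i₁ : Fin K}

lemma gap_eq (huniq : ∀ i, i ≠ i₁ → θ i < θ i₁) (i : Fin K) : gap θ i = θ i₁ - θ i := by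
  have h : ∀ j, θ j ≤ θ i₁ := fun j => by
    rcases eq_or_ne j i₁ with rfl | hj
    · exact le_rfl
    · exact (huniq j hj).le
  have : Nonempty (Fin K) := ⟨i₁⟩
  rw [gap, le_antisymm (ciSup_le h) (le_ciSup (Set.finite_range θ).bddAbove i₁)]

lemma gap_nonneg (θ : Fin K → ℝ) (i : Fin K) : 0 ≤ gap θ i :=
  sub_nonneg.mpr (le_ciSup (Set.finite_range θ).bddAbove i)

lemma gap_le {D : ℝ} (hθ : ∀ i, θ i ∈ Set.Icc 0 D) (i : Fin K) : gap θ i ≤ D := by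
  have : Nonempty (Fin K) := ⟨i⟩
  have h1 : ⨆ j, θ j ≤ D := ciSup_le fun j => (hθ j).2
  have h2 := (hθ i).1
  unfold gap
  linarith

lemma minGap_le {i : Fin K} (hi : i ≠ i₁) : minGap θ i₁ ≤ gap θ i :=
  ciInf_le (Set.finite_range fun i : {i : Fin K // i ≠ i₁} => gap θ i).bddBelow
    (⟨i, hi⟩ : {i : Fin K // i ≠ i₁})

lemma minGap_pos (hK : 2 ≤ K) (huniq : ∀ i, i ≠ i₁ → θ i < θ i₁) : 0 < minGap θ i₁ := by
  have : Nontrivial (Fin K) := Fin.nontrivial_iff_two_le.mpr hK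
  have : Nonempty {i : Fin K // i ≠ i₁} := by
    obtain ⟨i, hi⟩ := exists_ne i₁
    exact ⟨⟨i, hi⟩⟩
  obtain ⟨i, hi⟩ := exists_eq_ciInf_of_finite (f := fun i : {i : Fin K // i ≠ i₁} => gap θ i)
  rw [minGap, ← hi, gap_eq huniq]
  exact sub_pos.mpr (huniq i i.2)

/-- The regret of a list of plays. -/
def listRegret (θ : Fin K → ℝ) (l : List (Fin K)) : ℝ := (l.map (gap θ)).sum

lemma listRegret_append (l l' : List (Fin K)) :
    listRegret θ (l ++ l') = listRegret θ l + listRegret θ l' := by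
  simp [listRegret]

lemma listRegret_nonneg (θ : Fin K → ℝ) (l : List (Fin K)) : 0 ≤ listRegret θ l :=
  List.sum_nonneg fun y hy => by
    obtain ⟨i, -, rfl⟩ := List.mem_map.mp hy
    exact gap_nonneg θ i

lemma listRegret_le_length_mul {l : List (Fin K)} {b : ℝ} (h : ∀ i ∈ l, gap θ i ≤ b) :
    listRegret θ l ≤ l.length * b := by
  have := List.sum_le_card_nsmul (l.map (gap θ)) b (by simpa using h)
  simpa [listRegret] using this

lemma sum_count_mul_gap [DecidableEq (Fin K)] (l : List (Fin K)) :
    ∑ i, (l.count i : ℝ) * gap θ i = listRegret θ l := by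
  induction l with
  | nil => simp [listRegret]
  | cons a l ih =>
    have h : listRegret θ (a :: l) = gap θ a + listRegret θ l := by simp [listRegret]
    rw [h, ← ih]
    simp [List.count_cons, add_mul, Finset.sum_add_distrib, add_comm]

lemma regret_eq_listRegret {Sig : Fin K → Fin K → ℝ≥0∞} (ch : Choices Sig) (σ : ℝ≥0) (D δ : ℝ)
    (x : ℕ → Fin K → Fin K → ℝ) (T : ℕ) :
    regret ch σ D δ x θ T = listRegret θ (actions ch σ D δ x T) := sum_count_mul_gap _

lemma regret_le_listRegret_run {Sig : Fin K → Fin K → ℝ≥0∞} (ch : Choices Sig) (σ : ℝ≥0)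
    (D δ : ℝ) (x : ℕ → Fin K → Fin K → ℝ) (T : ℕ) :
    regret ch σ D δ x θ T ≤ listRegret θ (run ch σ D δ x T).plays := by
  rw [regret_eq_listRegret, actions]
  conv_rhs => rw [← List.take_append_drop T (run ch σ D δ x T).plays, listRegret_append]
  exact le_add_of_nonneg_right (listRegret_nonneg θ _)

end Gaps

/-! ### Consequences of the confidence bounds -/

section Confidence

variable {Sig : Fin K → Fin K → ℝ≥0∞} (ch : Choices Sig) (σ : ℝ≥0) (D δ : ℝ)
  (x : ℕ → Fin K → Fin K → ℝ) (θ : Fin K → ℝ) (T : ℕ)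

/-- All the confidence intervals that are computed before phase `T` ends are correct. -/
def ConfidenceHolds : Prop :=
  ∀ n, 1 ≤ n → n < T → ∀ i,
    |empMean Sig x (run ch σ D δ x n).plays i - θ i| ≤
      confWidth K σ δ (n + 1) (obsCount Sig (run ch σ D δ x n).plays i)

variable {ch σ D δ x θ T} {i₁ : Fin K}

lemma mem_run_succ_good {n : ℕ} (h : 2 ≤ (run ch σ D δ x n).good.card) {i : Fin K} :
    i ∈ (run ch σ D δ x (n + 1)).good ↔ i ∈ (run ch σ D δ x n).good ∧
      ∀ j ∈ (run ch σ D δ x n).good,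
        empMean Sig x (run ch σ D δ x (n + 1)).plays j -
            confWidth K σ δ (n + 2) (obsCount Sig (run ch σ D δ x (n + 1)).plays j) ≤
          empMean Sig x (run ch σ D δ x (n + 1)).plays i +
            confWidth K σ δ (n + 2) (obsCount Sig (run ch σ D δ x (n + 1)).plays i) := by
  classical
  rw [run_succ, step_good_of_two_le ch σ D δ x h, step_plays]
  simp only [survivors, Finset.mem_filter, run_phase]

lemma ConfidenceHolds.best_mem_good (hconf : ConfidenceHolds ch σ D δ x θ T)
    (huniq : ∀ i, i ≠ i₁ → θ i < θ i₁) {n : ℕ} (hn : n < T) :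
    i₁ ∈ (run ch σ D δ x n).good := by
  induction n with
  | zero => exact Finset.mem_univ _
  | succ n ih =>
    have hi := ih (by omega)
    rcases Nat.lt_or_ge 1 (run ch σ D δ x n).good.card with h | h
    · refine (mem_run_succ_good h).mpr ⟨hi, fun j _ => ?_⟩
      have h1 := abs_le.mp (hconf (n + 1) (by omega) hn j)
      have h2 := abs_le.mp (hconf (n + 1) (by omega) hn i₁)
      have h3 := gap_nonneg θ j
      rw [gap_eq huniq] at h3
      linarith [h1.2, h2.1]
    · rw [run_succ, step_good_of_card_le ch σ D δ x h]
      exact hi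

/-- Action `i` survived the comparison with `i₁`, so the gap is at most twice the sum of the two
confidence widths. Each width is at most `σ√(6L/ν)`, since the logarithm in it is at most `3L`. -/
lemma ConfidenceHolds.gap_le (hconf : ConfidenceHolds ch σ D δ x θ T)
    (huniq : ∀ i, i ≠ i₁ → θ i < θ i₁) {L : ℝ} (hL : 0 ≤ L)
    (hlog : ∀ r : ℕ, 1 ≤ r → r ≤ T → Real.log (8 * (K : ℝ) ^ 2 * (r : ℝ) ^ 3 / δ) ≤ 3 * L)
    {n : ℕ} (hn1 : 1 ≤ n) (hn : n < T) (hcard : 2 ≤ (run ch σ D δ x n).good.card)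
    {ν : ℝ} (hν : 0 < ν)
    (hνle : ∀ i ∈ (run ch σ D δ x n).good, ν ≤ obsCount Sig (run ch σ D δ x n).plays i)
    {i : Fin K} (hi : i ∈ (run ch σ D δ x n).good) :
    gap θ i ≤ 4 * σ * Real.sqrt (6 * L / ν) := by
  -- The good set after `m + 1` phases was filtered with the data of exactly these phases, so the
  -- current counts are those that entered the comparison.
  obtain ⟨m, rfl⟩ : ∃ m, n = m + 1 := ⟨n - 1, by omega⟩
  have hcard' : 2 ≤ (run ch σ D δ x m).good.card := hcard.trans (Finset.card_le_card (by
    rw [run_succ]; exact step_good_subset ch σ D δ x _))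
  have hbest := hconf.best_mem_good huniq hn
  have hwidth : ∀ j ∈ (run ch σ D δ x (m + 1)).good,
      confWidth K σ δ (m + 2) (obsCount Sig (run ch σ D δ x (m + 1)).plays j) ≤
        σ * Real.sqrt (6 * L / ν) := by
    intro j hj
    refine mul_le_mul_of_nonneg_left (Real.sqrt_le_sqrt ?_) σ.2
    refine div_le_div₀ (by positivity) ?_ hν (hνle j hj)
    have := hlog (m + 2) (by omega) (by omega)
    linarith
  have h0 := ((mem_run_succ_good hcard').mp hi).2 i₁ ((mem_run_succ_good hcard').mp hbest).1
  have h1 := (abs_le.mp (hconf (m + 1) (by omega) hn i)).2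
  have h2 := (abs_le.mp (hconf (m + 1) (by omega) hn i₁)).1
  have h3 := hwidth i hi
  have h4 := hwidth i₁ hbest
  rw [gap_eq huniq]
  simp only [Nat.add_assoc, Nat.reduceAdd] at h1 h2
  linarith

/-- As long as some suboptimal action is good, observation counts are small. -/
lemma ConfidenceHolds.le_of_le_obsCount (hconf : ConfidenceHolds ch σ D δ x θ T) (hK : 2 ≤ K)
    (huniq : ∀ i, i ≠ i₁ → θ i < θ i₁) {L : ℝ} (hL : 0 ≤ L)
    (hlog : ∀ r : ℕ, 1 ≤ r → r ≤ T → Real.log (8 * (K : ℝ) ^ 2 * (r : ℝ) ^ 3 / δ) ≤ 3 * L)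
    {n : ℕ} (hn1 : 1 ≤ n) (hn : n < T) (hcard : 2 ≤ (run ch σ D δ x n).good.card)
    {ν : ℝ}
    (hνle : ∀ i ∈ (run ch σ D δ x n).good, ν ≤ obsCount Sig (run ch σ D δ x n).plays i) :
    ν ≤ 96 * (σ : ℝ) ^ 2 * L / minGap θ i₁ ^ 2 := by
  have hd := minGap_pos hK huniq
  rcases le_or_gt ν 0 with hν | hν
  · exact hν.trans (by positivity)
  obtain ⟨i, hi, hne⟩ := Finset.exists_mem_ne (show 1 < _ from hcard) i₁
  have h1 := (minGap_le hne).trans (hconf.gap_le huniq hL hlog hn1 hn hcard hν hνle hi)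
  -- Squaring `d ≤ 4σ√(6L/ν)` produces the constant `96 = 16 · 6`.
  have h2 := pow_le_pow_left₀ hd.le h1 2
  rw [mul_pow, Real.sq_sqrt (by positivity)] at h2
  rw [le_div_iff₀ (by positivity)]
  calc ν * minGap θ i₁ ^ 2 ≤ ν * ((4 * σ) ^ 2 * (6 * L / ν)) := by gcongr
    _ = 96 * (σ : ℝ) ^ 2 * L := by field_simp; ring

end Confidence

/-! ### The budget of the phases that explore the weakly observed actions -/

section Budget

variable {Sig : Fin K → Fin K → ℝ≥0∞}

/-- Bookkeeping for the number `τ` of plays in phases that explored weakly observed actions: at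
the start of the last of these phases `a` was the value of `α`, `ℓ` the least number of
observations of a good action, `q` the size of the support of the allocation, and `J` consists
of all actions that have been explored so far. -/
structure WeakBudget (ch : Choices Sig) (σ : ℝ≥0) (D N ρ : ℝ) (s : State K)
    (τ a ℓ q : ℝ) (J : Finset (Fin K)) : Prop where
  plays_le : τ ≤ 2 * (ℓ / a + K * J.card + q)
  level_nonneg : 0 ≤ ℓ
  supp_nonneg : 0 ≤ q
  supp_le : q ≤ K
  inv_le : ρ⁻¹ ≤ a
  alpha_le : alphaOf ch s ≤ a
  level_le : ℓ ≤ N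
  level_le_rpow : ℓ ≤ ((σ : ℝ) * a * s.plays.length / D) ^ ((2 : ℝ) / 3)
  level_le_obsCount : ∀ i ∈ s.good, ℓ ≤ obsCount Sig s.plays i
  explored : ∀ i ∈ s.good, i ∈ J → ℓ + a * q ≤ obsCount Sig s.plays i ∧ i ∈ weakPart Sig s.good

variable {ch : Choices Sig} {σ : ℝ≥0} {D N ρ δ : ℝ} {x : ℕ → Fin K → Fin K → ℝ} {s : State K}
  {τ a ℓ q : ℝ} {J : Finset (Fin K)}

/-- Fewer good actions observe less: a weak action stays weak until it is eliminated. Hence explored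
actions that are still good remain in the weak part. -/
lemma weakPart_step {i : Fin K} (hi : i ∈ weakPart Sig s.good)
    (hi' : i ∈ (step ch σ D δ x s).good) : i ∈ weakPart Sig (step ch σ D δ x s).good := by
  rw [mem_weakPart] at hi ⊢
  exact ⟨hi', fun j hj => hi.2 j (step_good_subset ch σ D δ x s hj)⟩

/-- Consequently, an action that is strong now was strong in all earlier phases, and every ordinary
phase has contributed observations of it. -/
lemma strongPart_step {i : Fin K} (hi : i ∈ strongPart Sig (step ch σ D δ x s).good) :
    i ∈ strongPart Sig s.good := by
  rw [mem_strongPart] at hi ⊢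
  obtain ⟨h1, j, hj, hij⟩ := hi
  exact ⟨step_good_subset ch σ D δ x s h1, j, step_good_subset ch σ D δ x s hj, hij⟩

lemma obsCount_step (i : Fin K) : (obsCount Sig (step ch σ D δ x s).plays i : ℝ) =
    obsCount Sig s.plays i + obsCount Sig (phasePlays ch σ D s) i := by
  rw [step_plays, obsCount_append, Nat.cast_add]

lemma length_step : ((step ch σ D δ x s).plays.length : ℝ) =
    s.plays.length + (phasePlays ch σ D s).length := by
  rw [step_plays, List.length_append, Nat.cast_add]

lemma WeakBudget.init (hobs : ∀ j, ∃ i, Sig i j < ⊤) (hD : 0 < D) (hN : 0 ≤ N) (hρ : 1 ≤ ρ) :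
    WeakBudget ch σ D N ρ (State.init K) 0 1 0 0 ∅ where
  plays_le := by simp
  level_nonneg := le_rfl
  supp_nonneg := le_rfl
  supp_le := Nat.cast_nonneg _
  inv_le := inv_le_one_of_one_le₀ hρ
  alpha_le := alphaOf_le_one_of_weakPart_eq_empty ch _ fun A hA => by
    rw [Finset.mem_singleton.mp hA, weakPart_univ hobs]
  level_le := hN
  level_le_rpow := by positivity
  level_le_obsCount := fun i _ => Nat.cast_nonneg _
  explored := by simp

lemma WeakBudget.step (h : WeakBudget ch σ D N ρ s τ a ℓ q J) (hD : 0 < D) (hρ : 1 ≤ ρ) :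
    WeakBudget ch σ D N ρ (step ch σ D δ x s) τ a ℓ q J := by
  have ha : 0 < a := (inv_pos.mpr (by linarith)).trans_le h.inv_le
  have hcount : ∀ i, (obsCount Sig s.plays i : ℝ) ≤
      obsCount Sig (SideObs.step ch σ D δ x s).plays i := fun i => by
    rw [obsCount_step]; exact le_add_of_nonneg_right (Nat.cast_nonneg _)
  have hsub := step_good_subset ch σ D δ x s
  exact
  { h with
    alpha_le := (alphaOf_le_of_subset ch (hist_subset_step_hist ch σ D δ x s)).trans h.alpha_le
    level_le_rpow := h.level_le_rpow.trans (by
      rw [length_step]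
      refine Real.rpow_le_rpow (by positivity) ?_ (by norm_num)
      gcongr
      exact le_add_of_nonneg_right (Nat.cast_nonneg _))
    level_le_obsCount := fun i hi => (h.level_le_obsCount i (hsub hi)).trans (hcount i)
    explored := fun i hi hJ =>
      ⟨(h.explored i (hsub hi) hJ).1.trans (hcount i),
        weakPart_step (h.explored i (hsub hi) hJ).2 hi⟩ }

lemma WeakBudget.step_of_isWeakPhase (h : WeakBudget ch σ D N ρ s τ a ℓ q J) (hD : 0 < D)
    (hρ : 1 ≤ ρ) (hcard : 2 ≤ s.good.card) (hmem : s.good ∈ s.hist)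
    (hα : ρ⁻¹ ≤ alphaOf ch s) (hw : IsWeakPhase ch σ D s)
    (hN : ∀ ν : ℝ, (∀ i ∈ s.good, ν ≤ obsCount Sig s.plays i) → ν ≤ N) :
    ∃ a' ℓ' q' J', WeakBudget ch σ D N ρ (SideObs.step ch σ D δ x s)
      (τ + (phasePlays ch σ D s).length) a' ℓ' q' J' := by
  classical
  obtain ⟨i₀, hi₀, hmin⟩ := exists_minOver_eq hw.1 (fun i => (obsCount Sig s.plays i : ℝ))
  set w : ℝ := (obsCount Sig s.plays i₀ : ℝ) with hwdef
  have hα0 : 0 < alphaOf ch s := (inv_pos.mpr (by linarith)).trans_le hα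
  have ha : 0 < a := hα0.trans_le h.alpha_le
  have hi₀g : i₀ ∈ s.good := (mem_weakPart.mp hi₀).1
  -- The condition for a weak phase compares with the strong part too, so the minimum over the weak
  -- part is a minimum over all good actions.
  have hwle : ∀ i ∈ s.good, w ≤ obsCount Sig s.plays i := by
    intro i hi
    rcases mem_strongPart_or_weakPart (Sig := Sig) hi with h1 | h1
    · have h2 := hw.2.1
      rw [hmin] at h2
      exact WithTop.coe_le_coe.mp (h2.le.trans (minOver_le h1))
    · exact WithTop.coe_le_coe.mp (hmin ▸ minOver_le h1)
  have hwγ : w ≤ ((σ : ℝ) * alphaOf ch s * s.plays.length / D) ^ ((2 : ℝ) / 3) := by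
    have h2 := hw.2.2
    rw [hmin] at h2
    exact (WithTop.coe_lt_coe.mp h2).le
  have hsub := step_good_subset ch σ D δ x s
  have hcount : ∀ i, (obsCount Sig s.plays i : ℝ) ≤
      obsCount Sig (SideObs.step ch σ D δ x s).plays i := fun i => by
    rw [obsCount_step]; exact le_add_of_nonneg_right (Nat.cast_nonneg _)
  have hlen := length_phasePlays_le ch σ D hcard
  refine ⟨alphaOf ch s, w, supportCard (explore ch σ D s), J ∪ weakPart Sig s.good, ?_⟩
  have hwa : w / a ≤ w / alphaOf ch s :=
    div_le_div_of_nonneg_left (Nat.cast_nonneg _) hα0 h.alpha_le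
  -- The support size `q` of the previous weak phase is paid for when the next one starts. If all
  -- targets had been explored before, the least observed one has at least `ℓ + a q` observations,
  -- so the level term has risen by `q`. Otherwise `J` gains an element, and `K ≥ q` pays.
  have hkey : ℓ / a + K * J.card + q ≤
      w / alphaOf ch s + K * (J ∪ weakPart Sig s.good).card := by
    by_cases hJ : weakPart Sig s.good ⊆ J
    · rw [Finset.union_eq_left.mpr hJ]
      have h1 := (h.explored i₀ hi₀g (hJ hi₀)).1
      have h2 : ℓ / a + q ≤ w / a := by
        rw [le_div_iff₀ ha]
        calc (ℓ / a + q) * a = ℓ + a * q := by field_simp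
          _ ≤ w := h1
      linarith
    · have h1 : J.card + 1 ≤ (J ∪ weakPart Sig s.good).card := by
        refine Finset.card_lt_card (Finset.ssubset_iff_subset_ne.mpr
          ⟨Finset.subset_union_left, fun he => hJ ?_⟩)
        rw [he]
        exact Finset.subset_union_right
      have h2 : ((J.card : ℝ) + 1) ≤ (J ∪ weakPart Sig s.good).card := by exact_mod_cast h1
      have h3 : ℓ / a ≤ w / a :=
        div_le_div_of_nonneg_right (h.level_le_obsCount i₀ hi₀g) ha.le
      have h4 := mul_le_mul_of_nonneg_left h2 (Nat.cast_nonneg (α := ℝ) K)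
      linarith [h.supp_le]
  exact
  { plays_le := by linarith [h.plays_le]
    level_nonneg := Nat.cast_nonneg _
    supp_nonneg := Nat.cast_nonneg _
    supp_le := by exact_mod_cast supportCard_le _
    inv_le := hα
    alpha_le := alphaOf_le_of_subset ch (hist_subset_step_hist ch σ D δ x s)
    level_le := hN w hwle
    level_le_rpow := hwγ.trans (by
      rw [length_step]
      refine Real.rpow_le_rpow (by positivity) ?_ (by norm_num)
      gcongr
      exact le_add_of_nonneg_right (Nat.cast_nonneg _))
    level_le_obsCount := fun i hi => (hwle i (hsub hi)).trans (hcount i)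
    explored := fun i hi hJ => by
      have hiW : i ∈ weakPart Sig s.good := by
        rcases Finset.mem_union.mp hJ with h1 | h1
        · exact (h.explored i (hsub hi) h1).2
        · exact h1
      refine ⟨?_, weakPart_step hiW hi⟩
      rw [obsCount_step]
      exact add_le_add (hwle i (hsub hi)) (obsCount_phasePlays_weak ch σ D hcard hmem hw hiW) }

end Budget

/-! ### Inequalities for cube roots -/

section CubeRoot

lemma rpow_third_pow {t : ℝ} (ht : 0 ≤ t) : (t ^ ((1 : ℝ) / 3)) ^ 3 = t := by
  rw [← Real.rpow_natCast, ← Real.rpow_mul ht]; norm_num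

lemma rpow_two_thirds_eq {t : ℝ} (ht : 0 ≤ t) :
    t ^ ((2 : ℝ) / 3) = (t ^ ((1 : ℝ) / 3)) ^ 2 := by
  rw [← Real.rpow_natCast, ← Real.rpow_mul ht]; norm_num

lemma rpow_two_thirds_pow {t : ℝ} (ht : 0 ≤ t) : (t ^ ((2 : ℝ) / 3)) ^ 3 = t ^ 2 := by
  rw [rpow_two_thirds_eq ht, pow_right_comm, rpow_third_pow ht]

/-- This is the comparison of `∑ t^{-1/3}` with its integral. In the cube roots `p`, `q` of `a`, `b`
it reads `(q - p)² (q + 2p) ≥ 0`. -/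
lemma sub_div_rpow_third_le {a b : ℝ} (ha : 0 ≤ a) (hb : 0 < b) :
    (b - a) / b ^ ((1 : ℝ) / 3) ≤ 3 / 2 * (b ^ ((2 : ℝ) / 3) - a ^ ((2 : ℝ) / 3)) := by
  have hp : 0 ≤ a ^ ((1 : ℝ) / 3) := by positivity
  have hq : 0 < b ^ ((1 : ℝ) / 3) := by positivity
  rw [rpow_two_thirds_eq ha, rpow_two_thirds_eq hb.le, div_le_iff₀ hq]
  have h1 := rpow_third_pow ha
  have h2 := rpow_third_pow hb.le
  set p := a ^ ((1 : ℝ) / 3)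
  set q := b ^ ((1 : ℝ) / 3)
  rw [← h1, ← h2]
  have h3 : 0 ≤ (q - p) ^ 2 * (q + 2 * p) := by positivity
  nlinarith

/-- Origin of the term `125σ²K³/D²` in `T₀`: cubing the conclusion turns it into the hypothesis
times `t²`. -/
lemma mul_rpow_two_thirds_le {k σ D t : ℝ} (hk : 0 ≤ k) (hσ : 0 ≤ σ) (hD : 0 < D) (ht : 0 ≤ t)
    (h : 125 * σ ^ 2 / D ^ 2 * k ^ 3 ≤ t) : 5 * k * (σ * t / D) ^ ((2 : ℝ) / 3) ≤ t := by
  rw [← pow_le_pow_iff_left₀ (by positivity) ht three_ne_zero, mul_pow,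
    rpow_two_thirds_pow (by positivity)]
  calc (5 * k) ^ 3 * (σ * t / D) ^ 2 = 125 * σ ^ 2 / D ^ 2 * k ^ 3 * t ^ 2 := by
        field_simp; ring
    _ ≤ t * t ^ 2 := by gcongr
    _ = t ^ 3 := by ring

/-- This converts the cap on the level into a bound on the number of plays. Here `a` may exceed one,
so both ranges are treated. -/
lemma rpow_two_thirds_div_le {k a b : ℝ} (hk : 1 ≤ k) (ha : k⁻¹ ≤ a) (hb : 0 ≤ b) :
    (a * b) ^ ((2 : ℝ) / 3) / a ≤ k * b ^ ((2 : ℝ) / 3) := by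
  have ha0 : 0 < a := (inv_pos.mpr (by linarith)).trans_le ha
  have hka : 1 ≤ k * a := by
    have := mul_le_mul_of_nonneg_left ha (by linarith : 0 ≤ k)
    rwa [mul_inv_cancel₀ (by linarith)] at this
  have h1 : a ^ ((2 : ℝ) / 3) ≤ k * a := by
    rcases le_total a 1 with h | h
    · exact (Real.rpow_le_one ha0.le h (by norm_num)).trans hka
    · calc a ^ ((2 : ℝ) / 3) ≤ a ^ (1 : ℝ) :=
            Real.rpow_le_rpow_of_exponent_le h (by norm_num)
        _ = a := Real.rpow_one a
        _ ≤ k * a := le_mul_of_one_le_left ha0.le hk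
  rw [Real.mul_rpow ha0.le hb, div_le_iff₀ ha0]
  calc a ^ ((2 : ℝ) / 3) * b ^ ((2 : ℝ) / 3) ≤ k * a * b ^ ((2 : ℝ) / 3) := by gcongr
    _ = k * b ^ ((2 : ℝ) / 3) * a := by ring

end CubeRoot

/-! ### The regret of the ordinary phases -/

section Invariant

variable {Sig : Fin K → Fin K → ℝ≥0∞}

/-- Bookkeeping for the regret at the start of a phase: `τ` counts the plays in phases that
explored weakly observed actions, `e` the other plays in phases that started before time `T₀`,
and `f` is the sum of `t ^ (-1/3)` over all remaining plays, in phases that started at time `t`. -/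
structure RegretInvariant (θ : Fin K → ℝ) (Sig : Fin K → Fin K → ℝ≥0∞) (D c T₀ Q : ℝ)
    (s : State K) (τ e f : ℝ) : Prop where
  regret_le : listRegret θ s.plays ≤ D * (τ + e) + c * f
  early_le_length : e ≤ s.plays.length
  early_le : e ≤ T₀ + 2 * K
  late_le_rpow : f ≤ 3 / 2 * (max ((s.plays.length : ℝ) - 2 * K) 0) ^ ((2 : ℝ) / 3)
  late_le : f ≤ 3 / 2 * Q + 2 * K
  strong : 2 ≤ s.good.card → ∀ i ∈ strongPart Sig s.good,
    (s.plays.length : ℝ) - τ ≤ 2 * K * obsCount Sig s.plays i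

variable {ch : Choices Sig} {σ : ℝ≥0} {D δ c T₀ Q : ℝ} {x : ℕ → Fin K → Fin K → ℝ}
  {s : State K} {θ : Fin K → ℝ} {τ e f : ℝ}

lemma RegretInvariant.init (hT₀ : 0 ≤ T₀) (hQ : 0 ≤ Q) :
    RegretInvariant θ Sig D c T₀ Q (State.init K) 0 0 0 where
  regret_le := by simp [listRegret, State.init]
  early_le_length := Nat.cast_nonneg _
  early_le := by positivity
  late_le_rpow := by positivity
  late_le := by positivity
  strong := fun _ i _ => by
    simp only [State.init, List.length_nil, Nat.cast_zero, sub_zero]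
    positivity

lemma listRegret_step : listRegret θ (step ch σ D δ x s).plays =
    listRegret θ s.plays + listRegret θ (phasePlays ch σ D s) := by
  rw [step_plays, listRegret_append]

lemma late_le_rpow_step (h : RegretInvariant θ Sig D c T₀ Q s τ e f) :
    f ≤ 3 / 2 * (max (((step ch σ D δ x s).plays.length : ℝ) - 2 * K) 0) ^ ((2 : ℝ) / 3) := by
  refine h.late_le_rpow.trans ?_
  have : (s.plays.length : ℝ) ≤ (SideObs.step ch σ D δ x s).plays.length := by
    rw [length_step]; exact le_add_of_nonneg_right (Nat.cast_nonneg _)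
  gcongr

lemma two_le_card_of_step (h : 2 ≤ (step ch σ D δ x s).good.card) : 2 ≤ s.good.card :=
  h.trans (Finset.card_le_card (step_good_subset ch σ D δ x s))

lemma RegretInvariant.step_of_card_le (h : RegretInvariant θ Sig D c T₀ Q s τ e f)
    (hcard : s.good.card ≤ 1) (hzero : listRegret θ (phasePlays ch σ D s) ≤ 0) :
    RegretInvariant θ Sig D c T₀ Q (step ch σ D δ x s) τ e f where
  regret_le := by rw [listRegret_step]; linarith [h.regret_le]
  early_le_length := by
    rw [length_step]; exact h.early_le_length.trans (le_add_of_nonneg_right (Nat.cast_nonneg _))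
  early_le := h.early_le
  late_le_rpow := late_le_rpow_step h
  late_le := h.late_le
  strong := fun hc => by have := two_le_card_of_step hc; omega

lemma RegretInvariant.step_of_isWeakPhase (h : RegretInvariant θ Sig D c T₀ Q s τ e f)
    (hgap : ∀ i, gap θ i ≤ D) :
    RegretInvariant θ Sig D c T₀ Q (step ch σ D δ x s) (τ + (phasePlays ch σ D s).length) e f where
  regret_le := by
    rw [listRegret_step]
    have := listRegret_le_length_mul (l := phasePlays ch σ D s) fun i _ => hgap i
    linarith [h.regret_le]
  early_le_length := by
    rw [length_step]; exact h.early_le_length.trans (le_add_of_nonneg_right (Nat.cast_nonneg _))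
  early_le := h.early_le
  late_le_rpow := late_le_rpow_step h
  late_le := h.late_le
  strong := fun hc i hi => by
    have h1 := h.strong (two_le_card_of_step hc) i (strongPart_step hi)
    rw [length_step, obsCount_step]
    have h2 : (0 : ℝ) ≤ 2 * K * obsCount Sig (phasePlays ch σ D s) i := by positivity
    linarith

/-- An ordinary phase lasts at most `2‖c‖₀` rounds and yields at least `‖c‖₀/K` observations of each
strong action; the ratio is `2K`. -/
lemma RegretInvariant.strong_step (h : RegretInvariant θ Sig D c T₀ Q s τ e f) (hK : 0 < K)
    (hw : ¬ IsWeakPhase ch σ D s) (hc : 2 ≤ (step ch σ D δ x s).good.card) {i : Fin K}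
    (hi : i ∈ strongPart Sig (step ch σ D δ x s).good) :
    ((step ch σ D δ x s).plays.length : ℝ) - τ ≤
      2 * K * obsCount Sig (step ch σ D δ x s).plays i := by
  have hc' := two_le_card_of_step hc
  have h1 := h.strong hc' i (strongPart_step hi)
  have h2 := obsCount_phasePlays_strong ch σ D hc' hw (strongPart_step hi)
  have h3 := length_phasePlays_le ch σ D hc'
  have hK' : (0 : ℝ) < K := by exact_mod_cast hK
  rw [inv_mul_le_iff₀ hK'] at h2
  rw [length_step, obsCount_step]
  linarith

lemma RegretInvariant.step_of_early (h : RegretInvariant θ Sig D c T₀ Q s τ e f) (hK : 0 < K)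
    (hgap : ∀ i, gap θ i ≤ D) (hw : ¬ IsWeakPhase ch σ D s) (ht : s.plays.length ≤ T₀) :
    RegretInvariant θ Sig D c T₀ Q (step ch σ D δ x s) τ (e + (phasePlays ch σ D s).length) f where
  regret_le := by
    rw [listRegret_step]
    have := listRegret_le_length_mul (l := phasePlays ch σ D s) fun i _ => hgap i
    linarith [h.regret_le]
  early_le_length := by rw [length_step]; linarith [h.early_le_length]
  early_le := by
    have : ((phasePlays ch σ D s).length : ℝ) ≤ 2 * K := by
      exact_mod_cast length_phasePlays_le_two_mul ch σ D s
    linarith [h.early_le_length]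
  late_le_rpow := late_le_rpow_step h
  late_le := h.late_le
  strong := fun hc _ hi => h.strong_step hK hw hc hi

lemma RegretInvariant.step_of_late (h : RegretInvariant θ Sig D c T₀ Q s τ e f) (hK : 0 < K)
    (hw : ¬ IsWeakPhase ch σ D s) (hT₀ : 2 * (K : ℝ) < T₀) (ht : T₀ ≤ s.plays.length)
    (htQ : (s.plays.length : ℝ) ^ ((2 : ℝ) / 3) ≤ Q)
    (hgap : ∀ i ∈ s.good, gap θ i ≤ c / (s.plays.length : ℝ) ^ ((1 : ℝ) / 3)) :
    RegretInvariant θ Sig D c T₀ Q (step ch σ D δ x s) τ e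
      (f + (phasePlays ch σ D s).length / (s.plays.length : ℝ) ^ ((1 : ℝ) / 3)) := by
  have hlen : ((phasePlays ch σ D s).length : ℝ) ≤ 2 * K := by
    exact_mod_cast length_phasePlays_le_two_mul ch σ D s
  have hK1 : (1 : ℝ) ≤ K := by exact_mod_cast hK
  have hΔ : (0 : ℝ) ≤ (phasePlays ch σ D s).length := Nat.cast_nonneg _
  have hf := h.late_le_rpow
  have hreg := listRegret_le_length_mul (l := phasePlays ch σ D s) fun i hi =>
    hgap i (mem_good_of_mem_phasePlays ch σ D hw hi)
  set t : ℝ := (s.plays.length : ℝ) with htdef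
  set Δ : ℝ := ((phasePlays ch σ D s).length : ℝ) with hΔdef
  have ht0 : 0 < t - 2 * K := by linarith
  rw [max_eq_left ht0.le] at hf
  constructor
  · rw [listRegret_step]
    have : c * (f + Δ / t ^ ((1 : ℝ) / 3)) = c * f + Δ * (c / t ^ ((1 : ℝ) / 3)) := by ring
    linarith [h.regret_le]
  · rw [length_step]; linarith [h.early_le_length]
  · exact h.early_le
  · rw [length_step, max_eq_left (by linarith)]
    have h1 := sub_div_rpow_third_le (a := t - 2 * K) (b := t + Δ - 2 * K) ht0.le
      (by linarith)
    -- The terms are evaluated at the start of a phase, while the integral comparison needs its end.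
    -- Shifting time by `2K`, the maximal length of a phase, makes up for this.
    have h2 : Δ / t ^ ((1 : ℝ) / 3) ≤
        (t + Δ - 2 * K - (t - 2 * K)) / (t + Δ - 2 * K) ^ ((1 : ℝ) / 3) := by
      rw [show t + Δ - 2 * K - (t - 2 * K) = Δ by ring]
      refine div_le_div_of_nonneg_left hΔ (Real.rpow_pos_of_pos (by linarith) _) ?_
      exact Real.rpow_le_rpow (by linarith) (by linarith) (by norm_num)
    linarith
  · have h1 : (t - 2 * K) ^ ((2 : ℝ) / 3) ≤ t ^ ((2 : ℝ) / 3) :=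
      Real.rpow_le_rpow ht0.le (by linarith) (by norm_num)
    -- The bound `Q` holds at the start of the phase only; the phase itself adds at most its length,
    -- whence the extra `2K`.
    have h2 : Δ / t ^ ((1 : ℝ) / 3) ≤ Δ :=
      div_le_self hΔ (Real.one_le_rpow (by linarith) (by norm_num))
    linarith
  · exact fun hc _ hi => h.strong_step hK hw hc hi

/-- Late in the run, all good actions have been observed often before an ordinary phase. -/
lemma le_obsCount_of_late {N ρ a ℓ q : ℝ} {J : Finset (Fin K)} (hK : 2 ≤ K) (hD : 0 < D)
    (hρ1 : 1 ≤ ρ) (hρK : ρ ≤ K)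
    (h : RegretInvariant θ Sig D c T₀ Q s τ e f) (hb : WeakBudget ch σ D N ρ s τ a ℓ q J)
    (hw : ¬ IsWeakPhase ch σ D s) (hcard : 2 ≤ s.good.card) (hα : ρ⁻¹ ≤ alphaOf ch s)
    (ht : (125 * (σ : ℝ) ^ 2 / D ^ 2 + 10) * K ^ 3 ≤ s.plays.length) {i : Fin K}
    (hi : i ∈ s.good) :
    ((σ : ℝ) * s.plays.length / (D * ρ)) ^ ((2 : ℝ) / 3) ≤ obsCount Sig s.plays i := by
  have hst := h.strong hcard
  set t : ℝ := (s.plays.length : ℝ) with htdef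
  have ht0 : 0 ≤ t := Nat.cast_nonneg _
  have hK' : (2 : ℝ) ≤ K := by exact_mod_cast hK
  have hρ0 : 0 < ρ := by linarith
  have hσ0 : (0 : ℝ) ≤ σ := σ.2
  have ha0 : 0 < a := (inv_pos.mpr hρ0).trans_le hb.inv_le
  have hpos : 0 ≤ 125 * (σ : ℝ) ^ 2 / D ^ 2 := by positivity
  have hK3 : (0 : ℝ) ≤ (K : ℝ) ^ 3 := by positivity
  have h5 := mul_rpow_two_thirds_le (k := K) (by linarith) hσ0 hD ht0 (by nlinarith)
  have hle : ((σ : ℝ) * t / (D * ρ)) ^ ((2 : ℝ) / 3) ≤ (σ * t / D) ^ ((2 : ℝ) / 3) := by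
    refine Real.rpow_le_rpow (by positivity) ?_ (by norm_num)
    refine div_le_div_of_nonneg_left (by positivity) hD ?_
    exact le_mul_of_one_le_right hD.le hρ1
  have hlevel : ℓ / a ≤ K * (σ * t / D) ^ ((2 : ℝ) / 3) := by
    have h1 := div_le_div_of_nonneg_right hb.level_le_rpow ha0.le
    rw [show (σ : ℝ) * a * s.plays.length / D = a * (σ * t / D) by ring] at h1
    refine h1.trans (rpow_two_thirds_div_le (by linarith) ?_ (by positivity))
    exact (inv_anti₀ hρ0 hρK).trans hb.inv_le
  have hτ : τ ≤ 2 * (K * (σ * t / D) ^ ((2 : ℝ) / 3) + K * K + K) := by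
    have hJ : (J.card : ℝ) ≤ K := by
      exact_mod_cast (Finset.card_le_univ J).trans_eq (Fintype.card_fin K)
    have h2 := mul_le_mul_of_nonneg_left hJ (by linarith : (0 : ℝ) ≤ K)
    linarith [hb.plays_le, hb.supp_le]
  have hstrong : ∀ j ∈ strongPart Sig s.good,
      (σ * t / D) ^ ((2 : ℝ) / 3) ≤ obsCount Sig s.plays j := by
    intro j hj
    have h1 := hst j hj
    -- With `y = (σt/D)^{2/3}` the goal needs `t - τ ≥ 2Ky`, for which `t ≥ 4Ky + 2K² + 2K`
    -- suffices. Four fifths of `t` cover `4Ky` by `h5`, and the remaining fifth is at least `2K³ ≥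
    -- 2K² + 2K`.
    have h2 : 10 * (K : ℝ) ^ 3 ≤ t := by nlinarith
    have h3 : 2 * (K : ℝ) * K + 2 * K ≤ 2 * K ^ 3 := by nlinarith [sq_nonneg (K : ℝ)]
    have h4 : 2 * (K : ℝ) * (σ * t / D) ^ ((2 : ℝ) / 3) ≤ 2 * K * obsCount Sig s.plays j := by
      linarith
    exact le_of_mul_le_mul_left h4 (by linarith)
  rcases mem_strongPart_or_weakPart (Sig := Sig) hi with hiS | hiW
  · exact hle.trans (hstrong i hiS)
  · have hor : ¬ (minOver (weakPart Sig s.good) (fun i => (obsCount Sig s.plays i : ℝ)) <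
          minOver (strongPart Sig s.good) (fun i => (obsCount Sig s.plays i : ℝ)) ∧
        minOver (weakPart Sig s.good) (fun i => (obsCount Sig s.plays i : ℝ)) <
          ((gammaOf ch σ D s : ℝ) : WithTop ℝ)) := fun h' => hw ⟨⟨i, hiW⟩, h'⟩
    rw [not_and_or, not_lt, not_lt] at hor
    -- Either the weak actions have kept up with the strong ones, or they have reached the cap `γ`,
    -- which is large enough because `α ≥ 1/ρ`.
    rcases hor with h1 | h1
    · refine hle.trans (WithTop.coe_le_coe.mp (le_trans ?_ (h1.trans (minOver_le hiW))))
      exact le_minOver fun j hj => WithTop.coe_le_coe.mpr (hstrong j hj)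
    · refine le_trans ?_ (WithTop.coe_le_coe.mp (h1.trans (minOver_le hiW)))
      refine Real.rpow_le_rpow (by positivity) ?_ (by norm_num)
      rw [show (σ : ℝ) * t / (D * ρ) = σ * ρ⁻¹ * t / D by field_simp]
      gcongr

end Invariant

/-! ### The regret on the event that all confidence intervals are correct -/

section Deterministic

variable {Sig : Fin K → Fin K → ℝ≥0∞} {ch : Choices Sig} {σ : ℝ≥0} {D δ : ℝ}
  {x : ℕ → Fin K → Fin K → ℝ} {θ : Fin K → ℝ} {T : ℕ} {i₁ : Fin K}

lemma ConfidenceHolds.phasePlays_regret_nonpos (hconf : ConfidenceHolds ch σ D δ x θ T)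
    (huniq : ∀ i, i ≠ i₁ → θ i < θ i₁) {n : ℕ} (hn : n < T)
    (hcard : (run ch σ D δ x n).good.card ≤ 1) :
    listRegret θ (phasePlays ch σ D (run ch σ D δ x n)) ≤ 0 := by
  have h : ∀ i ∈ phasePlays ch σ D (run ch σ D δ x n), gap θ i ≤ 0 := by
    intro i hi
    rw [phasePlays, if_pos hcard, Finset.mem_toList] at hi
    rw [Finset.card_le_one.mp hcard i hi i₁ (hconf.best_mem_good huniq hn), gap_eq huniq, sub_self]
  simpa using listRegret_le_length_mul h

/-- The bound on the gap of a late good action. -/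
lemma late_gap_le {σ D ρ L t g : ℝ} (hσ : 0 < σ) (hD : 0 < D) (hρ : 0 < ρ) (ht : 0 < t)
    (h : g ≤ 4 * σ * Real.sqrt (6 * L / (σ * t / (D * ρ)) ^ ((2 : ℝ) / 3))) :
    g ≤ 4 * Real.sqrt 6 * Real.sqrt L * (ρ * D * σ ^ 2) ^ ((1 : ℝ) / 3) /
      t ^ ((1 : ℝ) / 3) := by
  refine h.trans_eq ?_
  have hb : 0 < σ * t / (D * ρ) := by positivity
  have hprod : (ρ * D * σ ^ 2) ^ ((1 : ℝ) / 3) * (σ * t / (D * ρ)) ^ ((1 : ℝ) / 3) =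
      σ * t ^ ((1 : ℝ) / 3) := by
    rw [← Real.mul_rpow (by positivity) hb.le,
      show ρ * D * σ ^ 2 * (σ * t / (D * ρ)) = σ ^ 3 * t by field_simp,
      Real.mul_rpow (by positivity) ht.le, ← Real.rpow_natCast σ 3, ← Real.rpow_mul hσ.le]
    norm_num
  have h1 : 0 < (σ * t / (D * ρ)) ^ ((1 : ℝ) / 3) := by positivity
  have h2 : 0 < t ^ ((1 : ℝ) / 3) := by positivity
  rw [rpow_two_thirds_eq hb.le, Real.sqrt_div' _ (by positivity), Real.sqrt_sq h1.le,
    Real.sqrt_mul (by norm_num)]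
  generalize (ρ * D * σ ^ 2) ^ ((1 : ℝ) / 3) = p at *
  generalize (σ * t / (D * ρ)) ^ ((1 : ℝ) / 3) = v at *
  field_simp
  linear_combination (-√L) * hprod

lemma late_time_le {σ D ρ N t : ℝ} (hσ : 0 < σ) (hD : 0 < D) (hρ : 0 < ρ) (ht : 0 ≤ t)
    (h : (σ * t / (D * ρ)) ^ ((2 : ℝ) / 3) ≤ N) :
    t ^ ((2 : ℝ) / 3) ≤ N * (D * ρ / σ) ^ ((2 : ℝ) / 3) := by
  calc t ^ ((2 : ℝ) / 3) = (σ * t / (D * ρ) * (D * ρ / σ)) ^ ((2 : ℝ) / 3) := by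
        congr 1; field_simp
    _ = (σ * t / (D * ρ)) ^ ((2 : ℝ) / 3) * (D * ρ / σ) ^ ((2 : ℝ) / 3) :=
        Real.mul_rpow (by positivity) (by positivity)
    _ ≤ _ := by gcongr

variable {L N ρ : ℝ}

/-- The two invariants are carried together with the same `τ`: a late ordinary phase is cheap only
because `WeakBudget` has kept `τ` small compared with the elapsed time. -/
lemma ConfidenceHolds.exists_invariant (hconf : ConfidenceHolds ch σ D δ x θ T) (hK : 2 ≤ K)
    (hD : 0 < D) (hσ : 0 < σ) (hobs : ∀ j, ∃ i, Sig i j < ⊤) (hθ : ∀ i, θ i ∈ Set.Icc 0 D)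
    (huniq : ∀ i, i ≠ i₁ → θ i < θ i₁) (hρ : ρ = max (weakDominationNumber Sig : ℝ) 1)
    (hL : 0 ≤ L)
    (hlog : ∀ r : ℕ, 1 ≤ r → r ≤ T → Real.log (8 * (K : ℝ) ^ 2 * (r : ℝ) ^ 3 / δ) ≤ 3 * L)
    (hN : N = 96 * (σ : ℝ) ^ 2 * L / minGap θ i₁ ^ 2) (n : ℕ) (hn : n ≤ T) :
    ∃ τ e f a ℓ q J, WeakBudget ch σ D N ρ (run ch σ D δ x n) τ a ℓ q J ∧
      RegretInvariant θ Sig D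
        (4 * Real.sqrt 6 * Real.sqrt L * (ρ * D * (σ : ℝ) ^ 2) ^ ((1 : ℝ) / 3))
        ((125 * (σ : ℝ) ^ 2 / D ^ 2 + 10) * K ^ 3) (N * (D * ρ / σ) ^ ((2 : ℝ) / 3))
        (run ch σ D δ x n) τ e f := by
  have hρ1 : 1 ≤ ρ := hρ ▸ le_max_right _ _
  have hK' : (2 : ℝ) ≤ K := by exact_mod_cast hK
  have hρK : ρ ≤ K := by
    rw [hρ]
    exact max_le (by exact_mod_cast weakDominationNumber_le Sig) (by linarith)
  have hσ' : (0 : ℝ) < σ := hσ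
  have hN0 : 0 ≤ N := by rw [hN]; positivity
  have hT₀ : 10 * (K : ℝ) ^ 3 ≤ (125 * (σ : ℝ) ^ 2 / D ^ 2 + 10) * K ^ 3 := by
    have : (0 : ℝ) ≤ 125 * (σ : ℝ) ^ 2 / D ^ 2 := by positivity
    gcongr
    linarith
  have hT₀K : 2 * (K : ℝ) < (125 * (σ : ℝ) ^ 2 / D ^ 2 + 10) * K ^ 3 := by
    refine lt_of_lt_of_le ?_ hT₀
    nlinarith [sq_nonneg (K : ℝ)]
  induction n with
  | zero =>
    exact ⟨0, 0, 0, 1, 0, 0, ∅, WeakBudget.init hobs hD hN0 hρ1,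
      RegretInvariant.init (by linarith) (by positivity)⟩
  | succ n ih =>
    obtain ⟨τ, e, f, a, ℓ, q, J, hb, hr⟩ := ih (by omega)
    rw [run_succ]
    rcases Nat.lt_or_ge 1 (run ch σ D δ x n).good.card with hcard | hcard
    swap
    · exact ⟨τ, e, f, a, ℓ, q, J, hb.step hD hρ1, hr.step_of_card_le hcard
        (hconf.phasePlays_regret_nonpos huniq (by omega) hcard)⟩
    have hα : ρ⁻¹ ≤ alphaOf ch (run ch σ D δ x n) :=
      hρ ▸ inv_le_alphaOf_run ch σ D δ x hobs hcard
    have hgap := SideObs.gap_le hθ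
    by_cases hw : IsWeakPhase ch σ D (run ch σ D δ x n)
    · have hn1 : 1 ≤ n := by
        by_contra h
        obtain rfl : n = 0 := by omega
        exact not_isWeakPhase_init ch σ D hobs hw
      obtain ⟨a', ℓ', q', J', hb'⟩ := hb.step_of_isWeakPhase (δ := δ) (x := x) hD hρ1 hcard
        (run_good_mem_hist ch σ D δ x n) hα hw fun ν hν => by
          rw [hN]
          exact hconf.le_of_le_obsCount hK huniq hL hlog hn1 (by omega) hcard hν
      exact ⟨_, e, f, a', ℓ', q', J', hb', hr.step_of_isWeakPhase hgap⟩
    rcases le_total ((run ch σ D δ x n).plays.length : ℝ)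
      ((125 * (σ : ℝ) ^ 2 / D ^ 2 + 10) * K ^ 3) with ht | ht
    · exact ⟨τ, _, f, a, ℓ, q, J, hb.step hD hρ1, hr.step_of_early (by omega) hgap hw ht⟩
    · have hlen : (0 : ℝ) < (run ch σ D δ x n).plays.length := by linarith
      have hn1 : 1 ≤ n := by
        by_contra h
        obtain rfl : n = 0 := by omega
        simp [run_zero, State.init] at hlen
      have hobsle := fun i (hi : i ∈ (run ch σ D δ x n).good) =>
        le_obsCount_of_late hK hD hρ1 hρK hr hb hw hcard hα ht hi
      have hρ0 : 0 < ρ := by linarith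
      refine ⟨τ, e, _, a, ℓ, q, J, hb.step hD hρ1, hr.step_of_late (by omega) hw hT₀K ht ?_ ?_⟩
      · refine late_time_le hσ' hD hρ0 hlen.le ?_
        rw [hN]
        exact hconf.le_of_le_obsCount hK huniq hL hlog hn1 (by omega) hcard hobsle
      · intro i hi
        exact late_gap_le hσ' hD hρ0 hlen
          (hconf.gap_le huniq hL hlog hn1 (by omega) hcard (by positivity) hobsle hi)

/-- The high probability regret bound as a function of `L = log (2 K T / δ)`. -/
def regretBound (K : ℕ) (D σ ρ d L : ℝ) : ℝ :=
  1603 * ρ * D * σ ^ 2 / d ^ 2 * L ^ ((3 : ℝ) / 2)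
    + 14 * (K : ℝ) ^ 3 * D + 125 * σ ^ 2 * (K : ℝ) ^ 3 / D
    + 15 * (ρ * D * σ ^ 2) ^ ((1 : ℝ) / 3) * (125 * σ ^ 2 / D ^ 2 + 10) * (K : ℝ) ^ 2
      * L ^ ((1 : ℝ) / 2)

lemma rpow_three_halves {L : ℝ} (hL : 0 ≤ L) : L ^ ((3 : ℝ) / 2) = L * Real.sqrt L := by
  rw [show (3 : ℝ) / 2 = 1 + 1 / 2 by norm_num, Real.rpow_add_of_nonneg hL (by norm_num)
    (by norm_num), Real.rpow_one, Real.sqrt_eq_rpow]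

lemma sqrt_six_le : Real.sqrt 6 ≤ 2.4495 := by
  rw [Real.sqrt_le_left (by norm_num)]; norm_num

/-- The powers of `σ`, `D`, `ρ` in the late part combine to `ρD`. The leading constant is `192 +
576√6 ≤ 1603`, and `14K³D` collects `10K³D` from `T₀` and at most `4K³D` from lower order terms. -/
lemma combine_le_regretBound {σ d k : ℝ} (hK : 2 ≤ K) (hk : k = K) (hD : 0 < D) (hσ : 0 < σ)
    (hρ : 1 ≤ ρ) (hd : 0 < d) (hL : 1 ≤ L) (hN : N = 96 * σ ^ 2 * L / d ^ 2) :
    D * (2 * (N * ρ + k * k + k) + ((125 * σ ^ 2 / D ^ 2 + 10) * k ^ 3 + 2 * k)) +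
      4 * Real.sqrt 6 * Real.sqrt L * (ρ * D * σ ^ 2) ^ ((1 : ℝ) / 3) *
        (3 / 2 * (N * (D * ρ / σ) ^ ((2 : ℝ) / 3)) + 2 * k) ≤ regretBound K D σ ρ d L := by
  have hk2 : 2 ≤ k := by rw [hk]; exact_mod_cast hK
  have hL0 : 0 ≤ L := by linarith
  have hsL : 1 ≤ Real.sqrt L := Real.one_le_sqrt.mpr hL
  have hρ0 : 0 < ρ := by linarith
  have hprod : (ρ * D * σ ^ 2) ^ ((1 : ℝ) / 3) * (D * ρ / σ) ^ ((2 : ℝ) / 3) = ρ * D := by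
    have h1 : 0 ≤ D * ρ / σ := by positivity
    have h2 : (D * ρ / σ) ^ ((2 : ℝ) / 3) = ((D * ρ / σ) ^ 2) ^ ((1 : ℝ) / 3) := by
      rw [← Real.rpow_natCast, ← Real.rpow_mul h1]; norm_num
    rw [h2, ← Real.mul_rpow (by positivity) (by positivity),
      show ρ * D * σ ^ 2 * (D * ρ / σ) ^ 2 = (ρ * D) ^ 3 by field_simp,
      ← Real.rpow_natCast, ← Real.rpow_mul (by positivity)]
    norm_num
  rw [regretBound, rpow_three_halves hL0, ← Real.sqrt_eq_rpow, ← hk]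
  set p := (ρ * D * σ ^ 2) ^ ((1 : ℝ) / 3)
  set v := (D * ρ / σ) ^ ((2 : ℝ) / 3)
  set S := Real.sqrt L
  have hp : 0 ≤ p := by positivity
  have hM : 0 ≤ ρ * D * σ ^ 2 * L / d ^ 2 := by positivity
  have e1 : D * (2 * (N * ρ)) = 192 * (ρ * D * σ ^ 2 * L / d ^ 2) := by rw [hN]; ring
  have e2 : 4 * √6 * S * p * (3 / 2 * (N * v)) = 576 * √6 * (ρ * D * σ ^ 2 * L / d ^ 2) * S := by
    calc 4 * √6 * S * p * (3 / 2 * (N * v)) = 6 * √6 * S * N * (p * v) := by ring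
      _ = _ := by rw [hprod, hN]; ring
  have e3 : 1603 * ρ * D * σ ^ 2 / d ^ 2 * (L * S) =
      1603 * (ρ * D * σ ^ 2 * L / d ^ 2) * S := by ring
  have e4 : D * ((125 * σ ^ 2 / D ^ 2 + 10) * k ^ 3) =
      125 * σ ^ 2 * k ^ 3 / D + 10 * k ^ 3 * D := by field_simp
  have i1 : 192 * (ρ * D * σ ^ 2 * L / d ^ 2) + 576 * √6 * (ρ * D * σ ^ 2 * L / d ^ 2) * S ≤
      1603 * (ρ * D * σ ^ 2 * L / d ^ 2) * S := by
    have h1 : ρ * D * σ ^ 2 * L / d ^ 2 ≤ ρ * D * σ ^ 2 * L / d ^ 2 * S :=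
      le_mul_of_one_le_right hM hsL
    have h2 := mul_le_mul_of_nonneg_right sqrt_six_le
      (hM.trans h1)
    nlinarith
  have i2 : D * (2 * (k * k + k) + 2 * k) ≤ 4 * k ^ 3 * D := by
    have : 2 * (k * k + k) + 2 * k ≤ 4 * k ^ 3 := by nlinarith [sq_nonneg k]
    nlinarith
  have i3 : 4 * √6 * S * p * (2 * k) ≤
      15 * p * (125 * σ ^ 2 / D ^ 2 + 10) * k ^ 2 * S := by
    have h1 : 0 ≤ 125 * σ ^ 2 / D ^ 2 := by positivity
    have h3 : 8 * √6 * k ≤ 15 * (125 * σ ^ 2 / D ^ 2 + 10) * k ^ 2 := by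
      have h4 : 150 * k ^ 2 ≤ 15 * (125 * σ ^ 2 / D ^ 2 + 10) * k ^ 2 := by
        gcongr; linarith
      have h5 : 8 * √6 * k ≤ 20 * k := by
        have := mul_le_mul_of_nonneg_right sqrt_six_le (by linarith : 0 ≤ k)
        linarith
      nlinarith
    have h6 : 0 ≤ p * S := by positivity
    have := mul_le_mul_of_nonneg_left h3 h6
    linarith
  linarith

/-- Without noise, one phase suffices. -/
lemma ConfidenceHolds.regret_le_of_sigma_eq_zero (hconf : ConfidenceHolds ch 0 D δ x θ T)
    (hK : 2 ≤ K) (hD : 0 < D) (hobs : ∀ j, ∃ i, Sig i j < ⊤) (hθ : ∀ i, θ i ∈ Set.Icc 0 D)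
    (huniq : ∀ i, i ≠ i₁ → θ i < θ i₁) (hL : 0 ≤ L)
    (hlog : ∀ r : ℕ, 1 ≤ r → r ≤ T → Real.log (8 * (K : ℝ) ^ 2 * (r : ℝ) ^ 3 / δ) ≤ 3 * L) :
    regret ch 0 D δ x θ T ≤ 2 * K * D := by
  refine (regret_le_listRegret_run ch 0 D δ x T).trans ?_
  have h : ∀ n ≤ T, listRegret θ (run ch 0 D δ x n).plays ≤ 2 * K * D := by
    intro n hn
    induction n with
    | zero =>
      simp only [run_zero, State.init, listRegret, List.map_nil, List.sum_nil]
      positivity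
    | succ n ih =>
      rw [run_succ, listRegret_step]
      rcases Nat.eq_zero_or_pos n with rfl | hn1
      · have h1 := listRegret_le_length_mul
          (l := phasePlays ch 0 D (run ch 0 D δ x 0)) fun i _ => SideObs.gap_le hθ i
        have h2 : ((phasePlays ch 0 D (run ch 0 D δ x 0)).length : ℝ) ≤ 2 * K := by
          exact_mod_cast length_phasePlays_le_two_mul ch 0 D _
        have h3 : listRegret θ (run ch 0 D δ x 0).plays = 0 := by
          simp [run_zero, State.init, listRegret]
        rw [h3, zero_add]
        exact h1.trans (mul_le_mul_of_nonneg_right h2 hD.le)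
      · have hcard : (run ch 0 D δ x n).good.card ≤ 1 := by
          by_contra hcard
          obtain ⟨m, rfl⟩ : ∃ m, n = m + 1 := ⟨n - 1, by omega⟩
          -- Every action has been observed once, and for `σ = 0` the count bound `N` vanishes: two
          -- good actions would give `1 ≤ 0`.
          have h1 := hconf.le_of_le_obsCount hK huniq hL hlog hn1 (by omega)
            (by omega) (ν := 1) fun i _ => by
              exact_mod_cast one_le_obsCount_run ch 0 D δ x hK hobs m i
          norm_num at h1
        linarith [ih (by omega), hconf.phasePlays_regret_nonpos huniq (by omega) hcard]
  exact h T le_rfl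

theorem ConfidenceHolds.regret_le (hconf : ConfidenceHolds ch σ D δ x θ T) (hK : 2 ≤ K)
    (hD : 0 < D) (hobs : ∀ j, ∃ i, Sig i j < ⊤) (hθ : ∀ i, θ i ∈ Set.Icc 0 D)
    (huniq : ∀ i, i ≠ i₁ → θ i < θ i₁) (hρ : ρ = max (weakDominationNumber Sig : ℝ) 1)
    (hL : 1 ≤ L)
    (hlog : ∀ r : ℕ, 1 ≤ r → r ≤ T → Real.log (8 * (K : ℝ) ^ 2 * (r : ℝ) ^ 3 / δ) ≤ 3 * L) :
    regret ch σ D δ x θ T ≤ regretBound K D σ ρ (minGap θ i₁) L := by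
  have hρ1 : 1 ≤ ρ := hρ ▸ le_max_right _ _
  have hK' : (2 : ℝ) ≤ K := by exact_mod_cast hK
  rcases eq_or_ne σ 0 with rfl | hσ
  · refine (hconf.regret_le_of_sigma_eq_zero hK hD hobs hθ huniq (by linarith) hlog).trans ?_
    have h1 : 2 * (K : ℝ) ≤ 14 * K ^ 3 := by nlinarith [sq_nonneg (K : ℝ)]
    have h2 := mul_le_mul_of_nonneg_right h1 hD.le
    simpa [regretBound] using h2
  have hσ0 : 0 < σ := pos_iff_ne_zero.mpr hσ
  obtain ⟨τ, e, f, a, ℓ, q, J, hb, hr⟩ := hconf.exists_invariant hK hD hσ0 hobs hθ huniq hρ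
    (by linarith) hlog rfl T le_rfl
  refine (regret_le_listRegret_run ch σ D δ x T).trans (hr.regret_le.trans (le_trans ?_
    (combine_le_regretBound hK rfl hD (NNReal.coe_pos.mpr hσ0) hρ1 (minGap_pos hK huniq) hL rfl)))
  have hρ0 : 0 < ρ := by linarith
  have ha0 : 0 < a := (inv_pos.mpr hρ0).trans_le hb.inv_le
  have hτ : τ ≤ 2 * (96 * (σ : ℝ) ^ 2 * L / minGap θ i₁ ^ 2 * ρ + K * K + K) := by
    have h1 : ℓ / a ≤ 96 * (σ : ℝ) ^ 2 * L / minGap θ i₁ ^ 2 * ρ := by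
      rw [div_eq_mul_inv]
      exact mul_le_mul hb.level_le (inv_le_of_inv_le₀ hρ0 hb.inv_le) (by positivity) (by positivity)
    have hJ : (J.card : ℝ) ≤ K := by
      exact_mod_cast (Finset.card_le_univ J).trans_eq (Fintype.card_fin K)
    have h2 := mul_le_mul_of_nonneg_left hJ (by linarith : (0 : ℝ) ≤ K)
    linarith [hb.plays_le, hb.supp_le]
  refine add_le_add (mul_le_mul_of_nonneg_left (add_le_add hτ hr.early_le) hD.le) ?_
  exact mul_le_mul_of_nonneg_left hr.late_le (by positivity)

end Deterministic

/-! ### Measurability of a run -/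

section Measurability

open MeasureTheory

/-- With countably many states, measurability of a run reduces to that of the events that it is in a
given state. -/
instance : Countable (State K) :=
  Function.Injective.countable
    (f := fun s : State K => (s.phase, s.plays, s.good, s.hist)) fun s s' h => by
      cases s; cases s'; simp_all

variable {Sig : Fin K → Fin K → ℝ≥0∞} (ch : Choices Sig) (σ : ℝ≥0) (D δ : ℝ)

lemma measurable_empMean (plays : List (Fin K)) (i : Fin K) :
    Measurable fun x : ℕ → Fin K → Fin K → ℝ => empMean Sig x plays i := by
  classical
  unfold empMean
  refine Measurable.div_const (Finset.measurable_sum _ fun t _ => ?_) _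
  split_ifs
  · fun_prop
  · exact measurable_const

lemma measurableSet_survivors_eq (s : State K) (plays : List (Fin K)) (F : Finset (Fin K)) :
    MeasurableSet {x : ℕ → Fin K → Fin K → ℝ |
      survivors (Sig := Sig) σ δ x s plays = F} := by
  classical
  have h : {x : ℕ → Fin K → Fin K → ℝ | survivors (Sig := Sig) σ δ x s plays = F} =
      {x | ∀ i, (i ∈ s.good ∧ ∀ j, j ∈ s.good →
        empMean Sig x plays j - confWidth K σ δ (s.phase + 1) (obsCount Sig plays j) ≤
        empMean Sig x plays i + confWidth K σ δ (s.phase + 1) (obsCount Sig plays i)) ↔ i ∈ F} := by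
    ext x
    simp only [survivors, Set.mem_ofPred_eq, Finset.ext_iff, Finset.mem_filter]
  rw [h]
  refine measurableSet_setOfPred.mpr (Measurable.forall fun i => Measurable.iff
    (Measurable.and measurable_const (Measurable.forall fun j =>
      Measurable.imp measurable_const ?_)) measurable_const)
  exact measurableSet_setOfPred.mp (measurableSet_le
    ((measurable_empMean plays j).sub_const _) ((measurable_empMean plays i).add_const _))

lemma measurableSet_step_eq (s s' : State K) :
    MeasurableSet {x : ℕ → Fin K → Fin K → ℝ | step ch σ D δ x s = s'} := by
  classical
  by_cases hc : s.good.card ≤ 1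
  · simp only [step, hc, if_true]
    exact MeasurableSet.const _
  · simp only [step, hc, if_false]
    set plays := s.plays ++ ch.order s.phase (playCounts (explore ch σ D s))
    have h : {x : ℕ → Fin K → Fin K → ℝ |
        ({ phase := s.phase + 1, plays := plays, good := survivors (Sig := Sig) σ δ x s plays,
           hist := insert (survivors (Sig := Sig) σ δ x s plays) s.hist } : State K) = s'} =
        ⋃ F : Finset (Fin K), {x | survivors (Sig := Sig) σ δ x s plays = F} ∩
          {_x | ({ phase := s.phase + 1, plays := plays, good := F,
                   hist := insert F s.hist } : State K) = s'} := by
      ext x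
      simp
    rw [h]
    exact MeasurableSet.iUnion fun F =>
      (measurableSet_survivors_eq σ δ s plays F).inter (MeasurableSet.const _)

lemma measurableSet_run_eq (n : ℕ) (s : State K) :
    MeasurableSet {x : ℕ → Fin K → Fin K → ℝ | run ch σ D δ x n = s} := by
  induction n generalizing s with
  | zero => exact MeasurableSet.const (State.init K = s)
  | succ n ih =>
    have h : {x : ℕ → Fin K → Fin K → ℝ | run ch σ D δ x (n + 1) = s} =
        ⋃ s', {x | run ch σ D δ x n = s'} ∩ {x | step ch σ D δ x s' = s} := by
      ext x
      simp [run_succ]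
    rw [h]
    exact MeasurableSet.iUnion fun s' => (ih s').inter (measurableSet_step_eq ch σ D δ s' s)

lemma measurableSet_run (n : ℕ) (p : State K → Prop) :
    MeasurableSet {x : ℕ → Fin K → Fin K → ℝ | p (run ch σ D δ x n)} := by
  have h : {x : ℕ → Fin K → Fin K → ℝ | p (run ch σ D δ x n)} =
      ⋃ s : {s // p s}, {x | run ch σ D δ x n = s} := by
    ext x
    simp
  rw [h]
  exact MeasurableSet.iUnion fun s => measurableSet_run_eq ch σ D δ n s

lemma measurable_comp_run (n : ℕ) (f : State K → ℝ) :
    Measurable fun x : ℕ → Fin K → Fin K → ℝ => f (run ch σ D δ x n) :=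
  fun S _ => measurableSet_run ch σ D δ n fun s => f s ∈ S

lemma measurable_regret (θ : Fin K → ℝ) (T : ℕ) :
    Measurable fun x : ℕ → Fin K → Fin K → ℝ => regret ch σ D δ x θ T := by
  simp only [regret_eq_listRegret, actions]
  exact measurable_comp_run ch σ D δ T fun s => listRegret θ (s.plays.take T)

end Measurability

/-! ### The exponential martingale -/

section Martingale

open MeasureTheory ProbabilityTheory

variable {Sig : Fin K → Fin K → ℝ≥0∞} {θ : Fin K → ℝ} {Ω : Type*} [MeasurableSpace Ω]
  {P : Measure Ω} {X : ℕ → Fin K → Fin K → Ω → ℝ}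

/-- The realisation of the environment. -/
def realization (X : ℕ → Fin K → Fin K → Ω → ℝ) (ω : Ω) : ℕ → Fin K → Fin K → ℝ :=
  fun t i j => X t i j ω

lemma IsGaussianEnvironment.measurable_realization (hX : IsGaussianEnvironment Sig θ P X) :
    Measurable (realization X) :=
  measurable_pi_lambda _ fun t => measurable_pi_lambda _ fun i => measurable_pi_lambda _ fun j =>
    hX.measurable t i j

/-- A function of the observations made before round `t` is independent of those of round `t`. -/
lemma IsGaussianEnvironment.indepFun_of_agreeBefore (hX : IsGaussianEnvironment Sig θ P X)
    {β : Type*} [MeasurableSpace β] {Φ : (ℕ → Fin K → Fin K → ℝ) → β} (hΦ : Measurable Φ) {t : ℕ}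
    (hpred : ∀ x y, AgreeBefore Sig t x y → Φ x = Φ y) {a i : Fin K} (hai : Sig a i < ⊤) :
    IndepFun (fun ω => Φ (realization X ω)) (X t a i) P := by
  classical
  have hind := hX.indep_time.indepFun_finset (Finset.range t) {t} (by simp) fun s =>
    measurable_pi_lambda _ fun p => hX.measurable s p.1.1 p.1.2
  -- A predictable function factors through the finitely many rounds before `t`: the other entries
  -- are replaced by zero, which `hpred` permits.
  let recon : ((s : Finset.range t) → {p : Fin K × Fin K // Sig p.1 p.2 < ⊤} → ℝ) →
      (ℕ → Fin K → Fin K → ℝ) := fun v s i j =>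
    if h : s ∈ Finset.range t ∧ Sig i j < ⊤ then v ⟨s, h.1⟩ ⟨(i, j), h.2⟩ else 0
  have hrecon : Measurable recon := by
    refine measurable_pi_lambda _ fun s => measurable_pi_lambda _ fun i =>
      measurable_pi_lambda _ fun j => ?_
    by_cases h : s ∈ Finset.range t ∧ Sig i j < ⊤
    · simp only [recon, dif_pos h]
      fun_prop
    · simp only [recon, dif_neg h]
      exact measurable_const
  have hev : Measurable fun v : (s : ({t} : Finset ℕ)) →
      {p : Fin K × Fin K // Sig p.1 p.2 < ⊤} → ℝ =>
      v ⟨t, Finset.mem_singleton_self t⟩ ⟨(a, i), hai⟩ := by fun_prop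
  have h := hind.comp (hΦ.comp hrecon) hev
  have he : (fun ω => Φ (realization X ω)) =
      (Φ ∘ recon) ∘ fun ω (s : Finset.range t) (p : {p : Fin K × Fin K // Sig p.1 p.2 < ⊤}) =>
        X s p.1.1 p.1.2 ω := by
    funext ω
    refine hpred _ _ fun s hs i j hij => ?_
    simp [recon, hs, hij, realization]
  rw [he]
  exact h

lemma lintegral_exp_gaussian {Y : Ω → ℝ} {μ : ℝ} {v : ℝ≥0}
    (hY : P.map Y = gaussianReal μ v) (l : ℝ) :
    ∫⁻ ω, ENNReal.ofReal (Real.exp (l * (Y ω - μ) - l ^ 2 * v / 2)) ∂P = 1 := by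
  have hm := mgf_gaussianReal hY l
  have hint : Integrable (fun ω => Real.exp (l * Y ω)) P := by
    -- A non-integrable function would have Bochner integral zero, while the Gaussian moment
    -- generating function is positive.
    by_contra h
    rw [mgf, integral_undef h] at hm
    exact (Real.exp_pos _).ne hm
  have he : ∀ ω, Real.exp (l * (Y ω - μ) - l ^ 2 * v / 2) =
      Real.exp (-(μ * l + v * l ^ 2 / 2)) * Real.exp (l * Y ω) := fun ω => by
    rw [← Real.exp_add]; congr 1; ring
  simp only [he]
  rw [← ofReal_integral_eq_lintegral_ofReal (hint.const_mul _)
    (Filter.Eventually.of_forall fun ω => by positivity), integral_const_mul]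
  rw [mgf] at hm
  rw [hm, ← Real.exp_add]
  simp

variable (ch : Choices Sig) (σ : ℝ≥0) (D δ : ℝ) (θ) (H : ℕ) (i : Fin K) (l : ℝ)

open Classical in
/-- The exponential weight of the observation of `i` in round `t` if the action `o` is played. -/
def roundWeight (x : ℕ → Fin K → Fin K → ℝ) (t : ℕ) : Option (Fin K) → ℝ≥0∞
  | none => 1
  | some a => if i ∈ obsSet Sig a then
      ENNReal.ofReal (Real.exp (l * (x t a i - θ i) - l ^ 2 * (σ ^ 2 : ℝ≥0) / 2)) else 1

/-- The exponential martingale of the observations of `i` made before round `t`. -/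
def expMartingale (x : ℕ → Fin K → Fin K → ℝ) (t : ℕ) : ℝ≥0∞ :=
  ∏ s ∈ Finset.range t, roundWeight (Sig := Sig) θ σ i l x s (run ch σ D δ x H).plays[s]?

variable {σ θ i l} in
lemma measurable_roundWeight (t : ℕ) (o : Option (Fin K)) :
    Measurable fun x => roundWeight (Sig := Sig) θ σ i l x t o := by
  classical
  rcases o with _ | a
  · exact measurable_const
  · simp only [roundWeight]
    split_ifs
    · fun_prop
    · exact measurable_const

lemma measurableSet_getElem?_eq (t : ℕ) (o : Option (Fin K)) :
    MeasurableSet {x : ℕ → Fin K → Fin K → ℝ | (run ch σ D δ x H).plays[t]? = o} :=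
  measurableSet_run ch σ D δ H fun s => s.plays[t]? = o

/-- Splitting by the played action replaces the random index by fixed ones, so that independence
applies to each term and no conditional expectation is needed. -/
lemma roundWeight_eq_sum (x : ℕ → Fin K → Fin K → ℝ) (t : ℕ) (b : ℝ≥0∞) :
    b * roundWeight (Sig := Sig) θ σ i l x t (run ch σ D δ x H).plays[t]? =
      ∑ o, (if (run ch σ D δ x H).plays[t]? = o then b else 0) *
        roundWeight (Sig := Sig) θ σ i l x t o := by
  simp [ite_mul]

lemma measurable_expMartingale (t : ℕ) :
    Measurable fun x => expMartingale θ ch σ D δ H i l x t := by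
  refine Finset.measurable_prod _ fun s _ => ?_
  have h : (fun x => roundWeight (Sig := Sig) θ σ i l x s (run ch σ D δ x H).plays[s]?) =
      fun x => ∑ o, (if (run ch σ D δ x H).plays[s]? = o then 1 else 0) *
        roundWeight (Sig := Sig) θ σ i l x s o := by
    ext x
    rw [← roundWeight_eq_sum, one_mul]
  rw [h]
  exact Finset.measurable_sum _ fun o _ =>
    (Measurable.ite (measurableSet_getElem?_eq ch σ D δ H s o) measurable_const
      measurable_const).mul (measurable_roundWeight s o)

lemma expMartingale_congr {x y : ℕ → Fin K → Fin K → ℝ} {t : ℕ} (h : AgreeBefore Sig t x y) :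
    expMartingale θ ch σ D δ H i l x t = expMartingale θ ch σ D δ H i l y t := by
  classical
  refine Finset.prod_congr rfl fun s hs => ?_
  have hst : s < t := Finset.mem_range.mp hs
  rw [run_plays_getElem?_congr ch σ D δ (fun u hu => h u (hu.trans hst)) H]
  rcases (run ch σ D δ y H).plays[s]? with _ | a
  · rfl
  · simp only [roundWeight]
    split_ifs with hi
    · rw [h s hst a i (mem_obsSet.mp hi)]
    · rfl

variable {θ}

/-- On the event that round `t` plays `a`, the earlier product is a function of the past, hence
independent of the new observation, whose weight has mean one. -/
lemma lintegral_expMartingale [IsProbabilityMeasure P] (hX : IsGaussianEnvironment Sig θ P X)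
    (hunif : ∀ i j, Sig i j = (σ : ℝ≥0∞) ^ 2 ∨ Sig i j = ⊤) (t : ℕ) :
    ∫⁻ ω, expMartingale θ ch σ D δ H i l (realization X ω) t ∂P = 1 := by
  classical
  have hXm := hX.measurable_realization
  induction t with
  | zero => simp [expMartingale]
  | succ t ih =>
    have hΦ : ∀ o : Option (Fin K), Measurable fun x =>
        if (run ch σ D δ x H).plays[t]? = o then expMartingale θ ch σ D δ H i l x t else 0 :=
      fun o => Measurable.ite (measurableSet_getElem?_eq ch σ D δ H t o)
        (measurable_expMartingale θ ch σ D δ H i l t) measurable_const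
    have hA : ∀ o : Option (Fin K), Measurable fun ω =>
        if (run ch σ D δ (realization X ω) H).plays[t]? = o then
          expMartingale θ ch σ D δ H i l (realization X ω) t else 0 :=
      fun o => (hΦ o).comp hXm
    have hB : ∀ o : Option (Fin K), Measurable fun ω =>
        (if (run ch σ D δ (realization X ω) H).plays[t]? = o then
          expMartingale θ ch σ D δ H i l (realization X ω) t else 0) *
        roundWeight (Sig := Sig) θ σ i l (realization X ω) t o :=
      fun o => (hA o).mul ((measurable_roundWeight t o).comp hXm)
    have hterm : ∀ o : Option (Fin K), ∫⁻ ω,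
        (if (run ch σ D δ (realization X ω) H).plays[t]? = o then
          expMartingale θ ch σ D δ H i l (realization X ω) t else 0) *
        roundWeight (Sig := Sig) θ σ i l (realization X ω) t o ∂P =
        ∫⁻ ω, (if (run ch σ D δ (realization X ω) H).plays[t]? = o then
          expMartingale θ ch σ D δ H i l (realization X ω) t else 0) ∂P := by
      rintro (_ | a)
      · simp [roundWeight]
      · by_cases hi : i ∈ obsSet Sig a
        · have hai := mem_obsSet.mp hi
          have hlaw := hX.law t a i hai
          rw [(hunif a i).resolve_right hai.ne, ENNReal.toNNReal_pow, ENNReal.toNNReal_coe] at hlaw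
          have hind := hX.indepFun_of_agreeBefore (hΦ (some a)) (t := t) (fun x y hxy => by
            rw [run_plays_getElem?_congr ch σ D δ hxy H,
              expMartingale_congr θ ch σ D δ H i l hxy]) hai
          have hψ : Measurable fun z : ℝ =>
              ENNReal.ofReal (Real.exp (l * (z - θ i) - l ^ 2 * (σ ^ 2 : ℝ≥0) / 2)) := by fun_prop
          have h := lintegral_mul_eq_lintegral_mul_lintegral_of_indepFun
            ((hΦ (some a)).comp hXm) (hψ.comp (hX.measurable t a i)) (hind.comp measurable_id hψ)
          have h1 := lintegral_exp_gaussian hlaw l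
          simp only [Function.comp_def, Pi.mul_apply] at h
          rw [h1, mul_one] at h
          simpa only [roundWeight, hi, if_true, realization] using h
        · simp [roundWeight, hi]
    calc ∫⁻ ω, expMartingale θ ch σ D δ H i l (realization X ω) (t + 1) ∂P
        = ∫⁻ ω, ∑ o, (if (run ch σ D δ (realization X ω) H).plays[t]? = o then
            expMartingale θ ch σ D δ H i l (realization X ω) t else 0) *
            roundWeight (Sig := Sig) θ σ i l (realization X ω) t o ∂P := by
          refine lintegral_congr fun ω => ?_
          rw [← roundWeight_eq_sum, expMartingale, Finset.prod_range_succ, expMartingale]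
      _ = ∑ o, ∫⁻ ω, (if (run ch σ D δ (realization X ω) H).plays[t]? = o then
            expMartingale θ ch σ D δ H i l (realization X ω) t else 0) ∂P := by
          rw [lintegral_finsetSum _ fun o _ => hB o]
          exact Finset.sum_congr rfl fun o _ => hterm o
      _ = ∫⁻ ω, expMartingale θ ch σ D δ H i l (realization X ω) t ∂P := by
          rw [← lintegral_finsetSum _ fun o _ => hA o]
          refine lintegral_congr fun ω => ?_
          simp
      _ = 1 := ih

variable (Sig) in
lemma sum_obs_eq_obsCount (plays : List (Fin K)) [∀ a, Decidable (i ∈ obsSet Sig a)] :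
    ∑ t : Fin plays.length, (if i ∈ obsSet Sig (plays.get t) then (1 : ℝ) else 0) =
      obsCount Sig plays i := by
  have h := Fin.sum_univ_fun_getElem plays fun a => if i ∈ obsSet Sig a then (1 : ℝ) else 0
  simp only [List.get_eq_getElem]
  refine h.trans ?_
  unfold obsCount
  clear h
  induction plays with
  | nil => simp
  | cons a l ih =>
    rw [List.map_cons, List.sum_cons, ih, List.countP_cons]
    by_cases ha : i ∈ obsSet Sig a <;> simp [ha, add_comm]

/-- Rounds after the end of the run have weight one, so at any later fixed time the product is
expressed through the final count and average. -/
lemma expMartingale_eq (x : ℕ → Fin K → Fin K → ℝ) {t : ℕ}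
    (ht : (run ch σ D δ x H).plays.length ≤ t)
    (hobs : obsCount Sig (run ch σ D δ x H).plays i ≠ 0) :
    expMartingale θ ch σ D δ H i l x t = ENNReal.ofReal (Real.exp
      (obsCount Sig (run ch σ D δ x H).plays i *
        (l * (empMean Sig x (run ch σ D δ x H).plays i - θ i) - l ^ 2 * (σ : ℝ) ^ 2 / 2))) := by
  classical
  unfold expMartingale
  generalize (run ch σ D δ x H).plays = plays at *
  have h1 : ∏ s ∈ Finset.range t, roundWeight (Sig := Sig) θ σ i l x s plays[s]? =
      ∏ s ∈ Finset.range plays.length, roundWeight (Sig := Sig) θ σ i l x s plays[s]? := by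
    refine (Finset.prod_subset (Finset.range_mono ht) fun s _ hs => ?_).symm
    rw [List.getElem?_eq_none (by simpa using hs)]
    rfl
  have h2 : ∀ s : Fin plays.length, roundWeight (Sig := Sig) θ σ i l x s plays[(s : ℕ)]? =
      ENNReal.ofReal (Real.exp (if i ∈ obsSet Sig (plays.get s) then
        l * (x s (plays.get s) i - θ i) - l ^ 2 * (σ : ℝ) ^ 2 / 2 else 0)) := by
    intro s
    rw [List.getElem?_eq_getElem s.2]
    unfold roundWeight
    simp only [List.get_eq_getElem]
    split_ifs
    · rfl
    · simp
  rw [h1, Finset.prod_range, Finset.prod_congr rfl fun s _ => h2 s,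
    ← ENNReal.ofReal_prod_of_nonneg fun s _ => (Real.exp_pos _).le, ← Real.exp_sum]
  congr 2
  have hn : (obsCount Sig plays i : ℝ) ≠ 0 := by exact_mod_cast hobs
  have hmean : (obsCount Sig plays i : ℝ) * empMean Sig x plays i =
      ∑ t : Fin plays.length,
        if i ∈ obsSet Sig (plays.get t) then x t (plays.get t) i else 0 := by
    unfold empMean
    rw [mul_div_cancel₀ _ hn]
  have hsplit : ∀ s : Fin plays.length, (if i ∈ obsSet Sig (plays.get s) then
        l * (x s (plays.get s) i - θ i) - l ^ 2 * (σ : ℝ) ^ 2 / 2 else 0) =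
      l * (if i ∈ obsSet Sig (plays.get s) then x s (plays.get s) i else 0) -
        (l * θ i + l ^ 2 * (σ : ℝ) ^ 2 / 2) *
          (if i ∈ obsSet Sig (plays.get s) then (1 : ℝ) else 0) := by
    intro s
    split_ifs <;> ring
  rw [Finset.sum_congr rfl fun s _ => hsplit s, Finset.sum_sub_distrib, ← Finset.mul_sum,
    ← Finset.mul_sum, sum_obs_eq_obsCount Sig i plays, ← hmean]
  ring

/-- Chernoff bound for the average of the observations of `i`. -/
lemma chernoff_empMean [IsProbabilityMeasure P] (hX : IsGaussianEnvironment Sig θ P X)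
    (hunif : ∀ i j, Sig i j = (σ : ℝ≥0∞) ^ 2 ∨ Sig i j = ⊤) (m : ℕ) (hm : m ≠ 0) (b : ℝ) :
    P.real {ω | obsCount Sig (run ch σ D δ (realization X ω) H).plays i = m ∧
      b ≤ m * (l * (empMean Sig (realization X ω)
        (run ch σ D δ (realization X ω) H).plays i - θ i) - l ^ 2 * (σ : ℝ) ^ 2 / 2)} ≤
      Real.exp (-b) := by
  -- The time `2KH` is deterministic and is at least the length of every run of `H` phases.
  have hM := (measurable_expMartingale θ ch σ D δ H i l (2 * K * H)).comp hX.measurable_realization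
  have h := mul_meas_ge_le_lintegral (μ := P) hM (ENNReal.ofReal (Real.exp b))
  simp only [Function.comp_def] at h
  rw [lintegral_expMartingale ch σ D δ H i l hX hunif] at h
  have h2 : P.real {ω | ENNReal.ofReal (Real.exp b) ≤
      expMartingale θ ch σ D δ H i l (realization X ω) (2 * K * H)} ≤ Real.exp (-b) := by
    have h3 := ENNReal.toReal_mono ENNReal.one_ne_top h
    rw [ENNReal.toReal_mul, ENNReal.toReal_ofReal (Real.exp_pos b).le, ENNReal.toReal_one] at h3
    rw [Real.exp_neg, ← one_div, le_div_iff₀ (Real.exp_pos b), mul_comm]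
    exact h3
  refine (measureReal_mono ?_ (measure_ne_top _ _)).trans h2
  rintro ω ⟨hcount, hb⟩
  rw [Set.mem_ofPred_eq, expMartingale_eq ch σ D δ H i l _ (length_run_plays_le ch σ D δ _ H)
    (by rw [hcount]; exact hm), hcount]
  exact ENNReal.ofReal_le_ofReal (Real.exp_le_exp.mpr hb)

end Martingale

/-! ### The probability that all confidence intervals are correct -/

section Probability

open MeasureTheory ProbabilityTheory

variable {Sig : Fin K → Fin K → ℝ≥0∞} {θ : Fin K → ℝ} {Ω : Type*} [MeasurableSpace Ω]
  {P : Measure Ω} {X : ℕ → Fin K → Fin K → Ω → ℝ}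
  {ch : Choices Sig} {σ : ℝ≥0} {D δ : ℝ}

lemma not_confidenceHolds_le_of_zero (hX : IsGaussianEnvironment Sig θ P X)
    (hunif : ∀ i j, Sig i j = ((0 : ℝ≥0) : ℝ≥0∞) ^ 2 ∨ Sig i j = ⊤) (hK : 2 ≤ K)
    (hobs : ∀ j, ∃ i, Sig i j < ⊤) (T : ℕ) :
    P.real {ω | ¬ ConfidenceHolds ch 0 D δ (realization X ω) θ T} ≤ 0 := by
  classical
  have hae : ∀ᵐ ω ∂P, ∀ t a i, Sig a i < ⊤ → X t a i ω = θ i := by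
    simp only [ae_all_iff]
    intro t a i hai
    have hlaw := hX.law t a i hai
    rw [(hunif a i).resolve_right hai.ne] at hlaw
    simp only [ENNReal.coe_zero, ne_eq, OfNat.ofNat_ne_zero, not_false_eq_true, zero_pow,
      ENNReal.toNNReal_zero, gaussianReal_zero_var] at hlaw
    have h1 : ∀ᵐ y ∂(P.map (X t a i)), y = θ i := by
      rw [hlaw, ae_dirac_eq]
      exact Filter.eventually_pure.mpr rfl
    exact ae_of_ae_map (hX.measurable t a i).aemeasurable h1
  have h0 : P {ω | ¬ ConfidenceHolds ch 0 D δ (realization X ω) θ T} = 0 := by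
    refine ae_iff.mp (hae.mono fun ω hall => ?_)
    intro n hn1 hn i
    obtain ⟨m, rfl⟩ : ∃ m, n = m + 1 := ⟨n - 1, by omega⟩
    have hpos := one_le_obsCount_run ch 0 D δ (realization X ω) hK hobs m i
    set plays := (run ch 0 D δ (realization X ω) (m + 1)).plays
    have hne : (obsCount Sig plays i : ℝ) ≠ 0 := by
      have : obsCount Sig plays i ≠ 0 := by omega
      exact_mod_cast this
    have hmean : empMean Sig (realization X ω) plays i = θ i := by
      unfold empMean
      rw [div_eq_iff hne, ← sum_obs_eq_obsCount Sig i plays, Finset.mul_sum]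
      refine Finset.sum_congr rfl fun t _ => ?_
      split_ifs with ht
      · rw [mul_one]
        exact hall t _ i (mem_obsSet.mp ht)
      · simp
    rw [hmean]
    simp [confWidth]
  rw [Measure.real, h0]
  simp

variable [IsProbabilityMeasure P]

/-- Chernoff's bound is applied with the optimal parameters `±g/σ²`, which are deterministic because
the count is fixed to be `m`. The width is chosen such that each tail has probability at most
`δ/(8K²r³)`. -/
lemma deviation_le (hX : IsGaussianEnvironment Sig θ P X) (hσ : 0 < σ)
    (hunif : ∀ i j, Sig i j = (σ : ℝ≥0∞) ^ 2 ∨ Sig i j = ⊤) (hK : 1 ≤ K)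
    (hδ : δ ∈ Set.Ioo (0 : ℝ) 1) (H : ℕ) (i : Fin K) {r m : ℕ} (hr : 1 ≤ r) (hm : m ≠ 0) :
    P.real {ω | obsCount Sig (run ch σ D δ (realization X ω) H).plays i = m ∧
      confWidth K σ δ r m < |empMean Sig (realization X ω)
        (run ch σ D δ (realization X ω) H).plays i - θ i|} ≤
      2 * (δ / (8 * (K : ℝ) ^ 2 * (r : ℝ) ^ 3)) := by
  have hσ' : (0 : ℝ) < σ := hσ
  have hm' : (0 : ℝ) < m := by exact_mod_cast Nat.pos_of_ne_zero hm
  have hK' : (1 : ℝ) ≤ K := by exact_mod_cast hK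
  have hr' : (1 : ℝ) ≤ r := by exact_mod_cast hr
  have hq : 1 ≤ 8 * (K : ℝ) ^ 2 * (r : ℝ) ^ 3 := by
    have h1 : 1 ≤ (K : ℝ) ^ 2 := one_le_pow₀ hK'
    have h2 : 1 ≤ (r : ℝ) ^ 3 := one_le_pow₀ hr'
    nlinarith
  set g := confWidth K σ δ r m with hg
  set b := Real.log (8 * (K : ℝ) ^ 2 * (r : ℝ) ^ 3 / δ) with hb
  have hb0 : 0 ≤ b := Real.log_nonneg (by
    rw [le_div_iff₀ hδ.1]; linarith [hδ.2])
  have hg0 : 0 ≤ g := mul_nonneg hσ'.le (Real.sqrt_nonneg _)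
  have hg2 : m * (g ^ 2 / (σ : ℝ) ^ 2) = 2 * b := by
    rw [hg, confWidth, mul_pow, Real.sq_sqrt (by positivity)]
    field_simp
    rfl
  have hexp : Real.exp (-b) = δ / (8 * (K : ℝ) ^ 2 * (r : ℝ) ^ 3) := by
    rw [Real.exp_neg, hb, Real.exp_log (div_pos (by linarith) hδ.1), inv_div]
  have hup := chernoff_empMean ch σ D δ H i (g / (σ : ℝ) ^ 2) hX hunif m hm b
  have hdown := chernoff_empMean ch σ D δ H i (-(g / (σ : ℝ) ^ 2)) hX hunif m hm b
  rw [hexp] at hup hdown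
  have key : ∀ z : ℝ, g < z →
      b ≤ m * (g / (σ : ℝ) ^ 2 * z - (g / (σ : ℝ) ^ 2) ^ 2 * (σ : ℝ) ^ 2 / 2) := by
    intro z hz
    have h1 : g / (σ : ℝ) ^ 2 * g ≤ g / (σ : ℝ) ^ 2 * z := by gcongr
    have h2 : g / (σ : ℝ) ^ 2 * g = g ^ 2 / (σ : ℝ) ^ 2 := by ring
    have h3 : (g / (σ : ℝ) ^ 2) ^ 2 * (σ : ℝ) ^ 2 / 2 = g ^ 2 / (σ : ℝ) ^ 2 / 2 := by field_simp
    rw [h3]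
    calc b = m * (g ^ 2 / (σ : ℝ) ^ 2 - g ^ 2 / (σ : ℝ) ^ 2 / 2) := by linarith
      _ ≤ _ := by gcongr; linarith
  have h := (measureReal_union_le _ _).trans (add_le_add hup hdown)
  rw [two_mul]
  refine (measureReal_mono ?_ (measure_ne_top _ _)).trans h
  rintro ω ⟨hc, hz⟩
  rcases lt_abs.mp hz with hz | hz
  · exact Or.inl ⟨hc, key _ hz⟩
  · refine Or.inr ⟨hc, ?_⟩
    have := key _ hz
    rwa [neg_sq, neg_mul_comm]

/-- For each `n` the `K · 2Kn` terms sum to `δn/(2(n+1)³) ≤ δ(1/n - 1/(n+1))`, and these differences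
telescope. -/
lemma sum_deviation_le (hK : 1 ≤ K) (hδ : 0 ≤ δ) (T : ℕ) :
    ∑ n ∈ Finset.Ico 1 T, ∑ _i : Fin K, ∑ _m ∈ Finset.Icc 1 (2 * K * n),
      2 * (δ / (8 * (K : ℝ) ^ 2 * ((n + 1 : ℕ) : ℝ) ^ 3)) ≤ δ := by
  have hK' : (0 : ℝ) < K := by exact_mod_cast hK
  have h1 : ∀ n ∈ Finset.Ico 1 T, ∑ _i : Fin K, ∑ _m ∈ Finset.Icc 1 (2 * K * n),
      2 * (δ / (8 * (K : ℝ) ^ 2 * ((n + 1 : ℕ) : ℝ) ^ 3)) ≤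
      δ * ((n : ℝ)⁻¹ - ((n + 1 : ℕ) : ℝ)⁻¹) := by
    intro n hn
    have hn1 : (1 : ℝ) ≤ n := by exact_mod_cast (Finset.mem_Ico.mp hn).1
    have hn0 : (0 : ℝ) < n := by linarith
    simp only [Finset.sum_const, Finset.card_univ, Fintype.card_fin, Nat.card_Icc, nsmul_eq_mul,
      Nat.add_sub_cancel]
    push_cast
    have h2 : (K : ℝ) * (2 * K * n * (2 * (δ / (8 * K ^ 2 * (n + 1) ^ 3)))) =
        δ * (n / (2 * (n + 1) ^ 3)) := by field_simp; ring
    rw [h2]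
    refine mul_le_mul_of_nonneg_left ?_ hδ
    have h3 : (n : ℝ)⁻¹ - ((n : ℝ) + 1)⁻¹ = 1 / (n * (n + 1)) := by field_simp; ring
    rw [h3, div_le_div_iff₀ (by positivity) (by positivity)]
    nlinarith [mul_pos hn0 hn0, mul_pos (mul_pos hn0 hn0) hn0]
  refine (Finset.sum_le_sum h1).trans ?_
  rw [← Finset.mul_sum]
  refine mul_le_of_le_one_right hδ ?_
  rcases Nat.lt_or_ge T 1 with hT | hT
  · rw [Finset.Ico_eq_empty (by omega)]; simp
  · have h2 := Finset.sum_Ico_sub (fun n : ℕ => -((n : ℝ)⁻¹)) hT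
    have h3 : ∑ n ∈ Finset.Ico 1 T, ((n : ℝ)⁻¹ - ((n + 1 : ℕ) : ℝ)⁻¹) =
        ∑ n ∈ Finset.Ico 1 T, (-(((n + 1 : ℕ) : ℝ)⁻¹) - -((n : ℝ)⁻¹)) :=
      Finset.sum_congr rfl fun n _ => by ring
    rw [h3, h2]
    have : (0 : ℝ) ≤ (T : ℝ)⁻¹ := by positivity
    simp

lemma not_confidenceHolds_le_of_pos (hX : IsGaussianEnvironment Sig θ P X) (hσ : 0 < σ)
    (hunif : ∀ i j, Sig i j = (σ : ℝ≥0∞) ^ 2 ∨ Sig i j = ⊤) (hK : 2 ≤ K)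
    (hobs : ∀ j, ∃ i, Sig i j < ⊤) (hδ : δ ∈ Set.Ioo (0 : ℝ) 1) (T : ℕ) :
    P.real {ω | ¬ ConfidenceHolds ch σ D δ (realization X ω) θ T} ≤ δ := by
  refine le_trans ?_ (sum_deviation_le (K := K) (by omega) hδ.1.le T)
  have hsub : {ω | ¬ ConfidenceHolds ch σ D δ (realization X ω) θ T} ⊆
      ⋃ n ∈ Finset.Ico 1 T, ⋃ i ∈ (Finset.univ : Finset (Fin K)),
        ⋃ m ∈ Finset.Icc 1 (2 * K * n),
        {ω | obsCount Sig (run ch σ D δ (realization X ω) n).plays i = m ∧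
          confWidth K σ δ (n + 1) m < |empMean Sig (realization X ω)
            (run ch σ D δ (realization X ω) n).plays i - θ i|} := by
    intro ω hω
    simp only [ConfidenceHolds, Set.mem_ofPred_eq] at hω
    push Not at hω
    obtain ⟨n, hn1, hnT, i, hi⟩ := hω
    simp only [Set.mem_iUnion]
    -- The union over `m` absorbs the randomness of the count, which lies between `1` and `2Kn`
    -- after the first phase.
    refine ⟨n, Finset.mem_Ico.mpr ⟨hn1, hnT⟩, i, Finset.mem_univ i, _, ?_, rfl, hi⟩
    obtain ⟨m, rfl⟩ : ∃ m, n = m + 1 := ⟨n - 1, by omega⟩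
    exact Finset.mem_Icc.mpr ⟨one_le_obsCount_run ch σ D δ _ hK hobs m i,
      (obsCount_le_length _ _ _).trans (length_run_plays_le ch σ D δ _ _)⟩
  refine (measureReal_mono hsub (measure_ne_top _ _)).trans ?_
  refine (measureReal_biUnion_finset_le _ _).trans (Finset.sum_le_sum fun n _ => ?_)
  refine (measureReal_biUnion_finset_le _ _).trans (Finset.sum_le_sum fun i _ => ?_)
  refine (measureReal_biUnion_finset_le _ _).trans (Finset.sum_le_sum fun m hm => ?_)
  exact deviation_le hX hσ hunif (by omega) hδ n i (by omega)
    (by have := (Finset.mem_Icc.mp hm).1; omega)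

/-- The high probability regret bound. -/
theorem one_sub_le_regret_le_regretBound (hX : IsGaussianEnvironment Sig θ P X) (hK : 2 ≤ K)
    (hD : 0 < D) (hunif : ∀ i j, Sig i j = (σ : ℝ≥0∞) ^ 2 ∨ Sig i j = ⊤)
    (hobs : ∀ j, ∃ i, Sig i j < ⊤) (hθ : ∀ i, θ i ∈ Set.Icc 0 D) {i₁ : Fin K}
    (huniq : ∀ i, i ≠ i₁ → θ i < θ i₁) {T : ℕ} (hT : 1 ≤ T) (hδ : δ ∈ Set.Ioo (0 : ℝ) 1) :
    1 - δ ≤ P.real {ω | regret ch σ D δ (realization X ω) θ T ≤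
      regretBound K D σ (max (weakDominationNumber Sig : ℝ) 1) (minGap θ i₁)
        (Real.log (2 * K * T / δ))} := by
  have hbad : P.real {ω | ¬ ConfidenceHolds ch σ D δ (realization X ω) θ T} ≤ δ := by
    rcases eq_or_ne σ 0 with rfl | hσ
    · exact (not_confidenceHolds_le_of_zero hX hunif hK hobs T).trans hδ.1.le
    · exact not_confidenceHolds_le_of_pos hX (pos_iff_ne_zero.mpr hσ) hunif hK hobs hδ T
  have hδ0 := hδ.1
  have hK' : (2 : ℝ) ≤ K := by exact_mod_cast hK
  have hT' : (1 : ℝ) ≤ T := by exact_mod_cast hT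
  have hL : 1 ≤ Real.log (2 * K * T / δ) := by
    rw [Real.le_log_iff_exp_le (by positivity)]
    have h1 : 4 ≤ 2 * K * T / δ := by
      rw [le_div_iff₀ hδ0]
      nlinarith [hδ.2]
    linarith [Real.exp_one_lt_d9]
  -- The cube of `2KT/δ` dominates `8K²r³/δ`, which reduces all confidence levels to the single
  -- quantity `L`.
  have hlog : ∀ r : ℕ, 1 ≤ r → r ≤ T → Real.log (8 * (K : ℝ) ^ 2 * (r : ℝ) ^ 3 / δ) ≤
      3 * Real.log (2 * K * T / δ) := by
    intro r hr hrT
    have hr0 : (0 : ℝ) < r := by exact_mod_cast hr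
    have hrT' : (r : ℝ) ≤ T := by exact_mod_cast hrT
    have h3 : (3 : ℝ) * Real.log (2 * K * T / δ) = Real.log ((2 * K * T / δ) ^ 3) := by
      rw [Real.log_pow]; norm_num
    rw [h3]
    refine Real.log_le_log (by positivity) ?_
    rw [div_pow]
    have h4 : δ ^ 3 ≤ δ := by
      calc δ ^ 3 ≤ δ ^ 1 := pow_le_pow_of_le_one hδ0.le hδ.2.le (by norm_num)
        _ = δ := pow_one δ
    refine div_le_div₀ (by positivity) ?_ (by positivity) h4
    calc 8 * (K : ℝ) ^ 2 * (r : ℝ) ^ 3 ≤ 8 * (K : ℝ) ^ 3 * (T : ℝ) ^ 3 := by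
          gcongr
          · linarith
          · norm_num
      _ = (2 * (K : ℝ) * (T : ℝ)) ^ 3 := by ring
  set A := {ω | regret ch σ D δ (realization X ω) θ T ≤
      regretBound K D σ (max (weakDominationNumber Sig : ℝ) 1) (minGap θ i₁)
        (Real.log (2 * K * T / δ))}
  have hcover : (Set.univ : Set Ω) ⊆
      A ∪ {ω | ¬ ConfidenceHolds ch σ D δ (realization X ω) θ T} := by
    intro ω _
    by_cases h : ConfidenceHolds ch σ D δ (realization X ω) θ T
    · exact Or.inl (h.regret_le hK hD hobs hθ huniq rfl hL hlog)
    · exact Or.inr h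
  have h1 := (measureReal_mono (μ := P) hcover (measure_ne_top _ _)).trans
    (measureReal_union_le _ _)
  rw [probReal_univ] at h1
  linarith

/-! ### From high probability to expectation. -/

lemma regret_nonneg (x : ℕ → Fin K → Fin K → ℝ) (T : ℕ) : 0 ≤ regret ch σ D δ x θ T := by
  rw [regret_eq_listRegret]
  exact listRegret_nonneg θ _

lemma regret_le_mul (hD : 0 ≤ D) (hθ : ∀ i, θ i ∈ Set.Icc 0 D) (x : ℕ → Fin K → Fin K → ℝ)
    (T : ℕ) : regret ch σ D δ x θ T ≤ T * D := by
  rw [regret_eq_listRegret]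
  refine (listRegret_le_length_mul fun i _ => gap_le hθ i).trans ?_
  have : (actions ch σ D δ x T).length ≤ T := by
    rw [actions, List.length_take]; exact min_le_left _ _
  gcongr

/-- The regret bound in expectation, for `δ = 1 / T`. -/
theorem integral_regret_le (hX : IsGaussianEnvironment Sig θ P X) (hK : 2 ≤ K)
    (hD : 0 < D) (hunif : ∀ i j, Sig i j = (σ : ℝ≥0∞) ^ 2 ∨ Sig i j = ⊤)
    (hobs : ∀ j, ∃ i, Sig i j < ⊤) (hθ : ∀ i, θ i ∈ Set.Icc 0 D) {i₁ : Fin K}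
    (huniq : ∀ i, i ≠ i₁ → θ i < θ i₁) {T : ℕ} (hT : 2 ≤ T) :
    Integrable (fun ω => regret ch σ D (1 / (T : ℝ)) (realization X ω) θ T) P ∧
      ∫ ω, regret ch σ D (1 / (T : ℝ)) (realization X ω) θ T ∂P ≤
        regretBound K D σ (max (weakDominationNumber Sig : ℝ) 1) (minGap θ i₁)
          (Real.log (2 * K * T / (1 / (T : ℝ)))) + D := by
  have hT' : (2 : ℝ) ≤ T := by exact_mod_cast hT
  have hδ : 1 / (T : ℝ) ∈ Set.Ioo (0 : ℝ) 1 := by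
    refine ⟨by positivity, ?_⟩
    rw [div_lt_one (by linarith)]
    linarith
  have hprob := one_sub_le_regret_le_regretBound (ch := ch) hX hK hD hunif hobs hθ huniq
    (T := T) (by omega) hδ
  have hmeas : Measurable fun ω => regret ch σ D (1 / (T : ℝ)) (realization X ω) θ T :=
    (measurable_regret ch σ D _ θ T).comp hX.measurable_realization
  set B := regretBound K D σ (max (weakDominationNumber Sig : ℝ) 1) (minGap θ i₁)
    (Real.log (2 * K * T / (1 / (T : ℝ)))) with hB
  set A := {ω | regret ch σ D (1 / (T : ℝ)) (realization X ω) θ T ≤ B} with hA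
  have hAm : MeasurableSet A := measurableSet_le hmeas measurable_const
  have hint : Integrable (fun ω => regret ch σ D (1 / (T : ℝ)) (realization X ω) θ T) P := by
    refine Integrable.of_bound hmeas.aestronglyMeasurable (T * D)
      (Filter.Eventually.of_forall fun ω => ?_)
    rw [Real.norm_of_nonneg (regret_nonneg _ T)]
    exact regret_le_mul hD.le hθ _ T
  refine ⟨hint, ?_⟩
  have hB0 : 0 ≤ B := by
    have hlog : 0 ≤ Real.log (2 * K * T / (1 / (T : ℝ))) := by
      have hK' : (2 : ℝ) ≤ K := by exact_mod_cast hK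
      refine Real.log_nonneg ?_
      rw [le_div_iff₀ hδ.1]
      nlinarith [hδ.2]
    rw [hB, regretBound]
    positivity
  -- Off `A` the trivial bound `TD` is used; as `A` fails with probability at most `1/T`, this
  -- contributes at most `D`.
  have hpoint : ∀ ω, regret ch σ D (1 / (T : ℝ)) (realization X ω) θ T ≤
      B + Aᶜ.indicator (fun _ => T * D) ω := by
    intro ω
    by_cases h : ω ∈ A
    · rw [Set.indicator_of_notMem (by simpa using h), add_zero]
      exact h
    · rw [Set.indicator_of_mem h]
      linarith [regret_le_mul (ch := ch) (σ := σ) (δ := 1 / (T : ℝ)) hD.le hθ (realization X ω) T]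
  have hind : Integrable (Aᶜ.indicator fun _ : Ω => (T : ℝ) * D) P :=
    (integrable_const _).indicator hAm.compl
  refine (integral_mono hint ((integrable_const B).add hind) hpoint).trans ?_
  simp only [Pi.add_apply]
  rw [integral_add (integrable_const B) hind, integral_indicator_const _ hAm.compl,
    probReal_compl_eq_one_sub hAm, integral_const, probReal_univ, smul_eq_mul, smul_eq_mul, one_mul]
  have h1 : (1 - P.real A) * (T * D) ≤ 1 / (T : ℝ) * (T * D) := by
    gcongr
    linarith
  have h2 : 1 / (T : ℝ) * (T * D) = D := by field_simp
  linarith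

/-- Since `L ≥ 1`, every term of the bound is at most its value at `L = 1` times `L^{3/2}`. Since
`log T ≥ log 2`, the constant `log (2K)` in `L = log (2K) + 2 log T` is absorbed into a multiple of
`log T`. -/
lemma regretBound_le_log_rpow {σ ρ d : ℝ} (hK : 2 ≤ K) (hD : 0 < D) (hρ : 0 ≤ ρ)
    {T : ℕ} (hT : 2 ≤ T) :
    regretBound K D σ ρ d (Real.log (2 * K * T / (1 / (T : ℝ)))) + D ≤
      ((regretBound K D σ ρ d 1 + D) *
        ((Real.log (2 * K) + 2 * Real.log 2) / Real.log 2) ^ ((3 : ℝ) / 2)) *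
        Real.log T ^ ((3 : ℝ) / 2) := by
  have hK' : (2 : ℝ) ≤ K := by exact_mod_cast hK
  have hT' : (2 : ℝ) ≤ T := by exact_mod_cast hT
  have hlog2 : 0 < Real.log 2 := Real.log_pos (by norm_num)
  have hlogT : Real.log 2 ≤ Real.log T := Real.log_le_log (by norm_num) hT'
  have hlogK : 0 ≤ Real.log (2 * K) := Real.log_nonneg (by linarith)
  set L := Real.log (2 * K * T / (1 / (T : ℝ))) with hL
  have hLeq : L = Real.log (2 * K) + 2 * Real.log T := by
    rw [hL, show 2 * (K : ℝ) * T / (1 / (T : ℝ)) = 2 * K * (T * T) by field_simp,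
      Real.log_mul (by positivity) (by positivity),
      Real.log_mul (x := (T : ℝ)) (by positivity) (by positivity)]
    ring
  have hL1 : 1 ≤ L := by
    have h1 : Real.log 4 ≤ Real.log (2 * K) := Real.log_le_log (by norm_num) (by linarith)
    have h2 : Real.log 4 = 2 * Real.log 2 := by
      rw [show (4 : ℝ) = 2 ^ 2 by norm_num, Real.log_pow]; norm_num
    linarith [Real.log_two_gt_d9]
  have hLle : L ≤ (Real.log (2 * K) + 2 * Real.log 2) / Real.log 2 * Real.log T := by
    rw [hLeq, div_mul_eq_mul_div, le_div_iff₀ hlog2]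
    nlinarith
  have h32 : L ^ ((3 : ℝ) / 2) ≤
      ((Real.log (2 * K) + 2 * Real.log 2) / Real.log 2) ^ ((3 : ℝ) / 2) *
        Real.log T ^ ((3 : ℝ) / 2) := by
    rw [← Real.mul_rpow (by positivity) (by linarith)]
    exact Real.rpow_le_rpow (by linarith) hLle (by norm_num)
  have hone : 1 ≤ L ^ ((3 : ℝ) / 2) := Real.one_le_rpow hL1 (by norm_num)
  have h12 : L ^ ((1 : ℝ) / 2) ≤ L ^ ((3 : ℝ) / 2) :=
    Real.rpow_le_rpow_of_exponent_le hL1 (by norm_num)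
  have hB1 : 0 ≤ regretBound K D σ ρ d 1 := by
    rw [regretBound]; positivity
  have hmain : regretBound K D σ ρ d L + D ≤
      (regretBound K D σ ρ d 1 + D) * L ^ ((3 : ℝ) / 2) := by
    unfold regretBound
    simp only [Real.one_rpow, mul_one]
    have hc : 0 ≤ 14 * (K : ℝ) ^ 3 * D + 125 * σ ^ 2 * (K : ℝ) ^ 3 / D + D := by positivity
    have hc4 : 0 ≤ 15 * (ρ * D * σ ^ 2) ^ ((1 : ℝ) / 3) * (125 * σ ^ 2 / D ^ 2 + 10) *
        (K : ℝ) ^ 2 := by positivity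
    have h1 := mul_le_mul_of_nonneg_left hone hc
    have h2 := mul_le_mul_of_nonneg_left h12 hc4
    linarith
  calc _ ≤ (regretBound K D σ ρ d 1 + D) * L ^ ((3 : ℝ) / 2) := hmain
    _ ≤ _ := by
      rw [mul_assoc]
      exact mul_le_mul_of_nonneg_left h32 (by positivity)

end Probability

end SideObs

end

theorem mainTheorem7 (K : ℕ) (hK : 2 ≤ K) (D : ℝ) (hD : 0 < D) (σ : ℝ≥0)
    (Sig : Fin K → Fin K → ℝ≥0∞)
    (hunif : ∀ i j, Sig i j = (σ : ℝ≥0∞) ^ 2 ∨ Sig i j = ⊤)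
    (hobs : ∀ j, ∃ i, Sig i j < ⊤)
    (θ : Fin K → ℝ) (hθ : ∀ i, θ i ∈ Set.Icc 0 D)
    (i₁ : Fin K) (huniq : ∀ i, i ≠ i₁ → θ i < θ i₁)
    (ρ : ℝ) (hρ : ρ = max (SideObs.weakDominationNumber Sig : ℝ) 1) :
    (∀ (Ω : Type*) [MeasurableSpace Ω] (P : MeasureTheory.Measure Ω)
        [MeasureTheory.IsProbabilityMeasure P] (X : ℕ → Fin K → Fin K → Ω → ℝ)
        (_hX : SideObs.IsGaussianEnvironment Sig θ P X) (ch : SideObs.Choices Sig)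
        (T : ℕ) (_hT : 1 ≤ T) (δ : ℝ) (_hδ : δ ∈ Set.Ioo (0 : ℝ) 1),
        1 - δ ≤ P.real {ω | SideObs.regret ch σ D δ (fun t i j => X t i j ω) θ T ≤
          1603 * ρ * D * (σ : ℝ) ^ 2 / SideObs.minGap θ i₁ ^ 2
              * Real.log (2 * K * T / δ) ^ ((3 : ℝ) / 2)
            + 14 * (K : ℝ) ^ 3 * D + 125 * (σ : ℝ) ^ 2 * (K : ℝ) ^ 3 / D
            + 15 * (ρ * D * (σ : ℝ) ^ 2) ^ ((1 : ℝ) / 3)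
              * (125 * (σ : ℝ) ^ 2 / D ^ 2 + 10) * (K : ℝ) ^ 2
              * Real.log (2 * K * T / δ) ^ ((1 : ℝ) / 2)}) ∧
    (∃ C : ℝ, ∀ (Ω : Type*) [MeasurableSpace Ω] (P : MeasureTheory.Measure Ω)
        [MeasureTheory.IsProbabilityMeasure P] (X : ℕ → Fin K → Fin K → Ω → ℝ)
        (_hX : SideObs.IsGaussianEnvironment Sig θ P X) (ch : SideObs.Choices Sig)
        (T : ℕ) (_hT : 2 ≤ T),
        MeasureTheory.Integrable
          (fun ω => SideObs.regret ch σ D (1 / (T : ℝ)) (fun t i j => X t i j ω) θ T) P ∧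
        ∫ ω, SideObs.regret ch σ D (1 / (T : ℝ)) (fun t i j => X t i j ω) θ T ∂P ≤
          C * Real.log T ^ ((3 : ℝ) / 2)) := by
  subst hρ
  refine ⟨fun Ω _ P _ X hX ch T hT δ hδ =>
    SideObs.one_sub_le_regret_le_regretBound hX hK hD hunif hobs hθ huniq hT hδ,
    (SideObs.regretBound K D σ (max (SideObs.weakDominationNumber Sig : ℝ) 1)
        (SideObs.minGap θ i₁) 1 + D) *
      ((Real.log (2 * K) + 2 * Real.log 2) / Real.log 2) ^ ((3 : ℝ) / 2),
    fun Ω _ P _ X hX ch T hT => ?_⟩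
  have h := SideObs.integral_regret_le (ch := ch) hX hK hD hunif hobs hθ huniq hT
  exact ⟨h.1, h.2.trans (SideObs.regretBound_le_log_rpow hK hD (by positivity) hT)⟩
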